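/- Let $\omega$ and $\Omega$ be the first infinite and the first uncountable ordinal, and give spaces of ordinals the order topology. For a $C^*$-algebra $A$ let $\mathrm{Prim}(A)$ be the set of its primitive ideals (kernels of irreducible representations) with the hull-kernel topology. Write $P\approx Q$ if $f(P)=f(Q)$ for all bounded continuous $f:\mathrm{Prim}(A)\to\mathbb R$. Let $q_A(P)$ be the intersection of all primitive ideals equivalent to $P$, and let $\mathrm{Glimm}(A)=q_A(\mathrm{Prim}(A))$. On $\mathrm{Glimm}(A)$ let $\tau_q$ be the quotient topology of $q_A$, and let $\tau_{cr}$ be the weakest topology that makes continuous all $g:\mathrm{Glimm}(A)\to\mathbb R$ for which $g\circ q_A$ is bounded and continuous. Let $Y=([0,\Omega]\times[0,\omega])\setminus\{(\Omega,\omega)\}$, $S=\{\Omega\}\times[0,\omega)$ and $T=[0,\Omega)\times\{\omega\}$. Let $X=Y\cup\{y\}$ with $y\notin Y$, with the topology for which $Y$ is embedded homeomorphically, $\{y\}$ is open, and $\overline{\{y\}}=S\cup\{y\}$. Let $H$ be an infinite dimensional separable complex Hilbert space, $\mathcal L(H)$ the algebra of bounded operators and $\mathcal K(H)$ the ideal of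 compact operators. Then $H$ carries a sequence of mutually orthogonal projections with infinite dimensional ranges, and $X$ is a locally compact $T_0$-space. Let $(p_n)_{n\ge 0}$ be any such sequence. Put $B=C_0(Y)$, $D=C_0(S)$, $\rho:D\to\mathcal L(H)$, $\rho(f)=\sum_{n\ge 0} f(\Omega,n)p_n$, and $E=\rho(D)+\mathcal K(H)$. Let $\pi_1:B\to D$ be the restriction map, $\pi_2:E\to D$ the quotient map $\rho(d)+k\mapsto d$, and $$A=\{(b,e)\in B\oplus E \mid \pi_1(b)=\pi_2(e)\}.$$ Then $A$ is a $C^*$-algebra and there is a homeomorphism $\varphi:X\to\mathrm{Prim}(A)$ with $\varphi(x)=\{(b,e)\in A\mid b(x)=0\}$ for $x\in Y$ and $\varphi(y)=\{(b,e)\in A\mid e=0\}$, such that the following hold. 1. For $x,x'\in X$, $q_A(\varphi(x))=q_A(\varphi(x'))$ if and only if $x=x'$ or $x,x'\in S\cup\{y\}$. 2. The subset $K=q_A(\varphi(T\cup\{y\}))$ of $\mathrm{Glimm}(A)$ is $\tau_{cr}$-compact but not $\tau_q$-compact. 3. There are no $a\in A$ and $\alpha>0$ such that $K\subset\{G\in\mathrm{Glimm}(A)\mid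 \|a+G\|\ge\alpha\}$. -/

import Mathlib

namespace GlimmSpace

open Set Filter Topology
open scoped Ordinal ZeroAtInfty CStarAlgebra

section Prim

universe u

/-- A nonzero `*`-representation on a Hilbert space that is topologically irreducible: the only
closed invariant subspaces are `0` and the whole space. -/
structure IsIrreducibleRep {A : Type*} [NonUnitalCStarAlgebra A]
    {E : Type*} [NormedAddCommGroup E] [InnerProductSpace ℂ E] [CompleteSpace E]
    (π : A →⋆ₙₐ[ℂ] (E →L[ℂ] E)) : Prop where
  nonzero : ∃ a, π a ≠ 0
  irreducible : ∀ V : Submodule ℂ E, IsClosed (V : Set E) →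
    (∀ a, ∀ v ∈ V, π a v ∈ V) → V = ⊥ ∨ V = ⊤

/-- A primitive ideal is the kernel of an irreducible representation. (An irreducible
representation is cyclic, so a Hilbert space in the universe of `A` is no restriction.) -/
def IsPrimitiveIdeal {A : Type u} [NonUnitalCStarAlgebra A] (P : TwoSidedIdeal A) : Prop :=
  ∃ (E : Type u) (_ : NormedAddCommGroup E) (_ : InnerProductSpace ℂ E) (_ : CompleteSpace E)
    (π : A →⋆ₙₐ[ℂ] (E →L[ℂ] E)), IsIrreducibleRep π ∧ P = TwoSidedIdeal.ker π

/-- The set `Prim(A)` of primitive ideals of `A`. -/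
def Prim (A : Type u) [NonUnitalCStarAlgebra A] : Type u :=
  {P : TwoSidedIdeal A // IsPrimitiveIdeal P}

variable {A : Type u} [NonUnitalCStarAlgebra A]

/-- The underlying ideal of a point of `Prim(A)`. -/
def Prim.ideal (P : Prim A) : TwoSidedIdeal A := P.1

/-- The hull of an ideal: the primitive ideals that contain it. -/
def hull (I : TwoSidedIdeal A) : Set (Prim A) := {P | I ≤ P.ideal}

/-- Primitive ideals are prime; this is what makes the hulls the closed sets of a topology. -/
theorem IsPrimitiveIdeal.prime {P : TwoSidedIdeal A} (hP : IsPrimitiveIdeal P)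
    {a b : A} (h : ∀ x, a * x * b ∈ P) : a ∈ P ∨ b ∈ P := by
  obtain ⟨E, _, _, _, π, hπ, rfl⟩ := hP
  simp only [TwoSidedIdeal.mem_ker] at h ⊢
  by_contra! hab
  obtain ⟨ha, hb⟩ := hab
  let V : Submodule ℂ E := ⨅ x, LinearMap.ker (π (a * x)).toLinearMap
  have hmem : ∀ v, v ∈ V ↔ ∀ x, π (a * x) v = 0 := fun v => by simp [V]
  have hVc : IsClosed (V : Set E) := by
    have : (V : Set E) = ⋂ x, {v | π (a * x) v = 0} := by
      ext v; simp only [SetLike.mem_coe, hmem, mem_iInter, mem_ofPred_eq]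
    rw [this]
    exact isClosed_iInter fun x => isClosed_eq (π (a * x)).continuous continuous_const
  rcases hπ.irreducible V hVc (fun c v hv => by
      rw [hmem] at hv ⊢
      intro x
      have := hv (x * c)
      rwa [← mul_assoc, map_mul] at this) with hV | hV
  · apply hb
    ext v
    have : π b v ∈ V := by
      rw [hmem]; intro x
      have := DFunLike.congr_fun (h x) v
      rwa [map_mul] at this
    rw [hV] at this
    simpa using this
  · let W : Submodule ℂ E := ⨅ x, LinearMap.ker (π x).toLinearMap
    have hW : ∀ v, v ∈ W ↔ ∀ x, π x v = 0 := fun v => by simp [W]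
    have hWc : IsClosed (W : Set E) := by
      have : (W : Set E) = ⋂ x, {v | π x v = 0} := by
        ext v; simp only [SetLike.mem_coe, hW, mem_iInter, mem_ofPred_eq]
      rw [this]
      exact isClosed_iInter fun x => isClosed_eq (π x).continuous continuous_const
    rcases hπ.irreducible W hWc (fun c v hv => by
      rw [hW] at hv ⊢
      intro x
      rw [← mul_apply_eq_comp, ← map_mul]; exact hv _) with h0 | h0
    · apply ha
      have h1 : π (star a) = 0 := by
        ext v
        have : π (star a) v ∈ W := by
          rw [hW]; intro x
          have h2 : π (a * star x) = 0 := by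
            ext w
            exact (hmem w).1 (hV ▸ Submodule.mem_top) _
          have h3 : π (x * star a) = 0 := by
            have : x * star a = star (a * star x) := by simp
            rw [this, map_star, h2, star_zero]
          rw [map_mul] at h3
          exact DFunLike.congr_fun h3 v
        rw [h0] at this
        simpa using this
      rw [map_star] at h1
      simpa using h1
    · obtain ⟨c, hc⟩ := hπ.nonzero
      apply hc
      ext v
      exact (hW v).1 (h0 ▸ Submodule.mem_top) c

/-- The hull-kernel topology: the closed sets are exactly the hulls of ideals. -/
instance : TopologicalSpace (Prim A) :=
  TopologicalSpace.ofClosed {F | ∃ I : TwoSidedIdeal A, F = hull I}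
    ⟨⊤, by
      ext P
      simp only [mem_empty_iff_false, false_iff]
      intro h
      obtain ⟨E, _, _, _, π, hπ, hP⟩ := P.2
      obtain ⟨a, ha⟩ := hπ.nonzero
      have : a ∈ P.1 := h trivial
      rw [hP, TwoSidedIdeal.mem_ker] at this
      exact ha this⟩
    (fun S hS => ⟨⨆ I ∈ {I : TwoSidedIdeal A | hull I ∈ S}, I, by
      ext P
      simp only [hull, mem_sInter, mem_ofPred_eq, iSup_le_iff]
      refine ⟨fun h I hI => h _ hI, fun h F hF => ?_⟩
      obtain ⟨I, rfl⟩ := hS hF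
      exact h I hF⟩)
    (by
      rintro _ ⟨I, rfl⟩ _ ⟨J, rfl⟩
      refine ⟨I ⊓ J, ?_⟩
      ext P
      simp only [hull, mem_union, mem_ofPred_eq]
      refine ⟨fun h => h.elim inf_le_left.trans inf_le_right.trans, fun h => ?_⟩
      by_contra! hc
      obtain ⟨a, ha, haP⟩ := SetLike.not_le_iff_exists.1 hc.1
      obtain ⟨b, hb, hbP⟩ := SetLike.not_le_iff_exists.1 hc.2
      rcases P.2.prime (a := a) (b := b) (fun x => h ((TwoSidedIdeal.mem_inf _).2
        ⟨I.mul_mem_right _ _ (I.mul_mem_right _ _ ha), J.mul_mem_left _ _ hb⟩)) with h | h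
      exacts [haP h, hbP h])

theorem isClosed_prim_iff {F : Set (Prim A)} :
    IsClosed F ↔ ∃ I : TwoSidedIdeal A, F = hull I := by
  rw [← isOpen_compl_iff]
  change Fᶜᶜ ∈ {F | ∃ I : TwoSidedIdeal A, F = hull I} ↔ _
  rw [compl_compl]; rfl

/-- `P ≈ Q` if every bounded continuous real function on `Prim(A)` takes the same value at `P`
and `Q`. -/
def GlimmRel (P Q : Prim A) : Prop :=
  ∀ f : BoundedContinuousFunction (Prim A) ℝ, f P = f Q

/-- The kernel (intersection) of the equivalence class of `P`. -/
def glimmIdeal (P : Prim A) : TwoSidedIdeal A :=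
  sInf {I | ∃ Q : Prim A, GlimmRel P Q ∧ I = Q.ideal}

variable (A) in
/-- `Glimm(A)`: the set of the kernels of the equivalence classes of `≈`. -/
def Glimm : Type u := {G : TwoSidedIdeal A // ∃ P : Prim A, G = glimmIdeal P}

/-- The underlying ideal of a point of `Glimm(A)`. -/
def Glimm.ideal (G : Glimm A) : TwoSidedIdeal A := G.1

/-- The quotient map `q_A : Prim(A) → Glimm(A)`. -/
def glimmMap (P : Prim A) : Glimm A := ⟨glimmIdeal P, P, rfl⟩

variable (A) in
/-- `τ_q`: the quotient topology. -/
abbrev tauQ : TopologicalSpace (Glimm A) := TopologicalSpace.coinduced glimmMap inferInstance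

variable (A) in
/-- `τ_cr`: the weakest topology that makes continuous all the functions `g` on `Glimm(A)` that
arise by dropping a bounded continuous real function `f` on `Prim(A)`, i.e. `g ∘ q_A = f`. -/
abbrev tauCR : TopologicalSpace (Glimm A) :=
  ⨅ g : {g : Glimm A → ℝ //
      ∃ f : BoundedContinuousFunction (Prim A) ℝ, ∀ P, g (glimmMap P) = f P},
    TopologicalSpace.induced g.1 inferInstance

/-- The norm `‖a + G‖` of the class of `a` in the quotient of `A` by the ideal `G`. -/
noncomputable def quotientNorm (a : A) (G : TwoSidedIdeal A) : ℝ := ⨅ g : G, ‖a + g‖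

end Prim

section Plank

/-- `Y = ([0,Ω] × [0,ω]) \ {(Ω,ω)}`, where `Ω` is the first uncountable ordinal, with the subspace
topology of the product of the order topologies. -/
abbrev Plank : Type 1 :=
  {x : Iic (ω_ 1 : Ordinal.{0}) × Iic (ω : Ordinal.{0}) // x ≠ (⊤, ⊤)}

/-- `S = {Ω} × [0,ω)`. -/
def plankS : Set Plank := {x | x.1.1 = ⊤}

/-- `T = [0,Ω) × {ω}`. -/
def plankT : Set Plank := {x | x.1.2 = ⊤}

/-- The point `(Ω,n)` of `S`. -/
noncomputable def sPoint (n : ℕ) : plankS :=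
  ⟨⟨(⊤, ⟨(n : Ordinal.{0}), (Ordinal.natCast_lt_omega0 n).le⟩), fun h =>
    (Ordinal.natCast_lt_omega0 n).ne (congrArg Subtype.val (Prod.mk.inj h).2)⟩, rfl⟩

theorem sPoint_surjective : Function.Surjective sPoint := by
  rintro ⟨⟨⟨a, b⟩, hne⟩, ha⟩
  change a = ⊤ at ha
  subst ha
  have hb : (b : Ordinal) < ω := lt_of_le_of_ne b.2 fun h => hne (by
    congr 1
    exact Subtype.ext h)
  obtain ⟨n, hn⟩ := Ordinal.lt_omega0.1 hb
  refine ⟨n, Subtype.ext (Subtype.ext (Prod.ext rfl (Subtype.ext hn.symm)))⟩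

theorem sPoint_injective : Function.Injective sPoint := by
  intro m n h
  have : ((m : Ordinal.{0})) = n :=
    congrArg (fun s : plankS => ((s.1.1.2 : Iic (ω : Ordinal.{0})) : Ordinal.{0})) h
  exact_mod_cast this

theorem isClosed_plankS : IsClosed plankS :=
  isClosed_eq (continuous_fst.comp continuous_subtype_val) continuous_const

instance : DiscreteTopology plankS := by
  refine discreteTopology_iff_isOpen_singleton.2 fun s => ?_
  obtain ⟨n, rfl⟩ := sPoint_surjective s
  let g : plankS → Ordinal.{0} := fun s => ((s.1.1.2 : Iic (ω : Ordinal.{0})) : Ordinal.{0})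
  have hg : Continuous g :=
    continuous_subtype_val.comp (continuous_snd.comp
      (continuous_subtype_val.comp continuous_subtype_val))
  have hs : ({sPoint n} : Set plankS) = g ⁻¹' Iio (Order.succ (n : Ordinal)) ∩
      ⋂ m ∈ Finset.range n, {sPoint m}ᶜ := by
    ext s
    obtain ⟨k, rfl⟩ := sPoint_surjective s
    have : g (sPoint k) = k := rfl
    simp only [mem_singleton_iff, sPoint_injective.eq_iff, mem_inter_iff, mem_preimage, this,
      mem_Iio, Order.lt_succ_iff, Nat.cast_le, Finset.mem_range, mem_iInter, mem_compl_iff]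
    constructor
    · rintro rfl; exact ⟨le_rfl, fun i hi => hi.ne'⟩
    · rintro ⟨h1, h2⟩
      by_contra h
      exact h2 k (lt_of_le_of_ne h1 h) rfl
  rw [hs]
  exact (isOpen_Iio.preimage hg).inter
    (isOpen_biInter_finset fun m _ => isOpen_compl_singleton)

/-- The set `X = Y ∪ {y}`, with `extra` the additional point `y`. -/
inductive SpaceX : Type 1
  | emb (x : Plank) : SpaceX
  | extra : SpaceX

/-- The topology of `X` for which `Y` is embedded homeomorphically, `{y}` is open and the closure
of `{y}` is `S ∪ {y}` (see the three lemmas below). -/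
instance : TopologicalSpace SpaceX where
  IsOpen U := IsOpen (SpaceX.emb ⁻¹' U) ∧ ((∃ s ∈ plankS, SpaceX.emb s ∈ U) → SpaceX.extra ∈ U)
  isOpen_univ := ⟨isOpen_univ, fun _ => trivial⟩
  isOpen_inter U V hU hV := ⟨hU.1.inter hV.1, fun ⟨s, hs, hsU, hsV⟩ =>
    ⟨hU.2 ⟨s, hs, hsU⟩, hV.2 ⟨s, hs, hsV⟩⟩⟩
  isOpen_sUnion C hC := ⟨by
    rw [preimage_sUnion]; exact isOpen_biUnion fun U hU => (hC U hU).1,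
    fun ⟨s, hs, U, hU, hsU⟩ => ⟨U, hU, (hC U hU).2 ⟨s, hs, hsU⟩⟩⟩

theorem SpaceX.isOpen_iff {U : Set SpaceX} : IsOpen U ↔
    IsOpen (SpaceX.emb ⁻¹' U) ∧ ((∃ s ∈ plankS, SpaceX.emb s ∈ U) → SpaceX.extra ∈ U) := Iff.rfl

theorem SpaceX.isOpen_extra : IsOpen {SpaceX.extra} := by
  refine ⟨?_, fun _ => rfl⟩
  convert isOpen_empty (X := Plank)
  ext x
  simp

theorem SpaceX.closure_extra :
    closure {SpaceX.extra} = insert SpaceX.extra (SpaceX.emb '' plankS) := by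
  apply Subset.antisymm
  · refine closure_minimal (by simp) ?_
    rw [← isOpen_compl_iff]
    refine ⟨?_, ?_⟩
    · convert isClosed_plankS.isOpen_compl
      ext x
      simp
    · rintro ⟨s, hs, h⟩
      exact (h (Or.inr ⟨s, hs, rfl⟩)).elim
  · rintro x (rfl | ⟨s, hs, rfl⟩)
    · exact subset_closure rfl
    · refine mem_closure_iff.2 fun U hU hsU => ⟨_, hU.2 ⟨s, hs, hsU⟩, rfl⟩

theorem SpaceX.isEmbedding_emb : IsEmbedding SpaceX.emb := by
  refine ⟨⟨le_antisymm ?_ ?_⟩, fun _ _ h => SpaceX.emb.inj h⟩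
  · exact continuous_iff_le_induced.1 ⟨fun U hU => hU.1⟩
  · intro V hV
    refine isOpen_induced_iff.2 ⟨insert SpaceX.extra (SpaceX.emb '' V),
      ⟨?_, fun _ => Or.inl rfl⟩, ?_⟩ <;>
    · have : SpaceX.emb ⁻¹' insert SpaceX.extra (SpaceX.emb '' V) = V := by
        ext x
        simp
      first | exact this | (rw [this]; exact hV)

end Plank

section Algebra

/-- The restriction map `π₁ : B = C₀(Y) → D = C₀(S)`. -/
noncomputable def restrictS : C₀(Plank, ℂ) →⋆ₙₐ[ℂ] C₀(plankS, ℂ) where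
  toFun f := f.comp ⟨⟨Subtype.val, continuous_subtype_val⟩,
    isClosed_plankS.isClosedEmbedding_subtypeVal.tendsto_cocompact⟩
  map_smul' _ _ := rfl
  map_zero' := rfl
  map_add' _ _ := rfl
  map_mul' _ _ := rfl
  map_star' _ := rfl

theorem restrictS_apply (f : C₀(Plank, ℂ)) (s : plankS) : restrictS f s = f s := rfl

variable {H : Type*} [NormedAddCommGroup H] [InnerProductSpace ℂ H] [CompleteSpace H]

variable (H) in
/-- A sequence of mutually orthogonal projections on `H` with infinite dimensional ranges. -/
structure ProjSeq where
  proj : ℕ → H →L[ℂ] H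
  isStarProjection : ∀ n, IsStarProjection (proj n)
  orthogonal : ∀ m n, m ≠ n → proj m * proj n = 0
  infinite : ∀ n, ¬ FiniteDimensional ℂ (LinearMap.range (proj n).toLinearMap)

namespace ProjSeq

variable (p : ProjSeq H)

theorem inner_proj {m n : ℕ} (h : m ≠ n) (x y : H) :
    inner ℂ (p.proj m x) (p.proj n y) = 0 := by
  rw [← ContinuousLinearMap.adjoint_inner_right, ← ContinuousLinearMap.star_eq_adjoint,
    (p.isStarProjection m).isSelfAdjoint.star_eq, ← mul_apply_eq_comp,
    p.orthogonal m n h]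
  simp

theorem norm_sq_sum (s : Finset ℕ) (c : ℕ → ℂ) (x : H) :
    ‖(∑ n ∈ s, c n • p.proj n) x‖ ^ 2 = ∑ n ∈ s, ‖c n‖ ^ 2 * ‖p.proj n x‖ ^ 2 := by
  classical
  induction s using Finset.induction_on with
  | empty => simp
  | insert a s ha ih =>
    rw [Finset.sum_insert ha, Finset.sum_insert ha, ← ih, add_apply,
      sq, sq ‖(∑ n ∈ s, c n • p.proj n) x‖,
      norm_add_sq_eq_norm_sq_add_norm_sq_of_inner_eq_zero (𝕜 := ℂ)]
    · rw [smul_apply, norm_smul]; ring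
    · rw [sum_apply, inner_sum]
      refine Finset.sum_eq_zero fun n hn => ?_
      rw [smul_apply, smul_apply, inner_smul_left, inner_smul_right,
        p.inner_proj (by rintro rfl; exact ha hn)]
      simp

theorem sum_norm_sq_le (s : Finset ℕ) (x : H) : ∑ n ∈ s, ‖p.proj n x‖ ^ 2 ≤ ‖x‖ ^ 2 := by
  have h1 : ‖(∑ n ∈ s, p.proj n) x‖ ^ 2 = ∑ n ∈ s, ‖p.proj n x‖ ^ 2 := by
    simpa using p.norm_sq_sum s (fun _ => 1) x
  have h2 : ∑ n ∈ s, ‖p.proj n x‖ ^ 2 = (inner ℂ ((∑ n ∈ s, p.proj n) x) x).re := by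
    rw [sum_apply, sum_inner, Complex.re_sum]
    refine Finset.sum_congr rfl fun n _ => ?_
    rw [← inner_self_eq_norm_sq (𝕜 := ℂ), ← ContinuousLinearMap.adjoint_inner_left,
      ← ContinuousLinearMap.star_eq_adjoint,
      (p.isStarProjection n).isSelfAdjoint.star_eq, ← mul_apply_eq_comp,
      (p.isStarProjection n).isIdempotentElem.eq]
    rfl
  have h3 : ‖(∑ n ∈ s, p.proj n) x‖ ^ 2 ≤ ‖(∑ n ∈ s, p.proj n) x‖ * ‖x‖ := by
    rw [h1, h2]
    exact (Complex.re_le_norm _).trans (norm_inner_le_norm _ _)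
  rw [← h1]
  have h4 : ‖(∑ n ∈ s, p.proj n) x‖ ≤ ‖x‖ := by
    by_contra! h
    nlinarith [norm_nonneg x]
  gcongr

theorem norm_sum_le (s : Finset ℕ) (c : ℕ → ℂ) {C : ℝ} (hC : 0 ≤ C) (h : ∀ n ∈ s, ‖c n‖ ≤ C) :
    ‖∑ n ∈ s, c n • p.proj n‖ ≤ C := by
  refine ContinuousLinearMap.opNorm_le_bound _ hC fun x => ?_
  refine le_of_sq_le_sq ?_ (by positivity)
  rw [p.norm_sq_sum, mul_pow]
  calc ∑ n ∈ s, ‖c n‖ ^ 2 * ‖p.proj n x‖ ^ 2 ≤ ∑ n ∈ s, C ^ 2 * ‖p.proj n x‖ ^ 2 := by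
        gcongr with n hn; exact h n hn
    _ ≤ C ^ 2 * ‖x‖ ^ 2 := by
        rw [← Finset.mul_sum]; gcongr; exact p.sum_norm_sq_le s x

theorem summable (f : C₀(plankS, ℂ)) : Summable fun n => f (sPoint n) • p.proj n := by
  rw [summable_iff_vanishing_norm]
  intro ε hε
  have h0 : Tendsto (fun n => f (sPoint n)) cofinite (𝓝 0) := by
    have := f.zero_at_infty'
    rw [cocompact_eq_cofinite] at this
    exact this.comp sPoint_injective.tendsto_cofinite
  have hfin : {n | ¬ ‖f (sPoint n)‖ < ε / 2}.Finite := by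
    have := (tendsto_zero_iff_norm_tendsto_zero.1 h0).eventually (gt_mem_nhds (half_pos hε))
    exact this
  refine ⟨hfin.toFinset, fun t ht => ?_⟩
  refine (p.norm_sum_le t _ (half_pos hε).le fun n hn => ?_).trans_lt (half_lt_self hε)
  by_contra h
  exact Finset.disjoint_left.1 ht hn (hfin.mem_toFinset.2 (fun h' => h h'.le))

/-- The embedding `ρ : D → L(H)`, `ρ(f) = ∑ₙ f(Ω,n) pₙ` (norm convergent, see `summable`). -/
noncomputable def rho : C₀(plankS, ℂ) →⋆ₙₐ[ℂ] (H →L[ℂ] H) where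
  toFun f := ∑' n, f (sPoint n) • p.proj n
  map_smul' c f := by
    simp only [ZeroAtInftyContinuousMap.smul_apply, smul_assoc, MonoidHom.id_apply]
    exact tsum_const_smul'' c
  map_zero' := by simp
  map_add' f g := by
    simp only [ZeroAtInftyContinuousMap.add_apply, add_smul]
    exact (p.summable f).tsum_add (p.summable g)
  map_mul' f g := by
    rw [← (p.summable g).tsum_mul_left]
    refine tsum_congr fun n => ?_
    rw [← (p.summable f).tsum_mul_right, tsum_eq_single n]
    · rw [smul_mul_smul_comm, (p.isStarProjection n).isIdempotentElem.eq]; rfl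
    · intro m hm
      rw [smul_mul_smul_comm, p.orthogonal m n hm, smul_zero]
  map_star' f := by
    rw [tsum_star]
    refine tsum_congr fun n => ?_
    rw [star_smul, (p.isStarProjection n).isSelfAdjoint.star_eq]; rfl

theorem rho_apply (f : C₀(plankS, ℂ)) : p.rho f = ∑' n, f (sPoint n) • p.proj n := rfl

theorem proj_mul_rho (n : ℕ) (f : C₀(plankS, ℂ)) :
    p.proj n * p.rho f = f (sPoint n) • p.proj n := by
  rw [rho_apply, ← (p.summable f).tsum_mul_left, tsum_eq_single n]
  · rw [mul_smul_comm, (p.isStarProjection n).isIdempotentElem.eq]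
  · intro m hm
    rw [mul_smul_comm, p.orthogonal n m hm.symm, smul_zero]

theorem not_isCompactOperator_proj (n : ℕ) : ¬ IsCompactOperator (p.proj n) := by
  intro h
  refine p.infinite n ?_
  set V := LinearMap.range (p.proj n).toLinearMap
  have hid : ∀ v ∈ V, p.proj n v = v := by
    rintro _ ⟨x, rfl⟩
    change p.proj n (p.proj n x) = p.proj n x
    rw [← mul_apply_eq_comp, (p.isStarProjection n).isIdempotentElem.eq]
  have hc : IsClosed (V : Set H) := by
    have : (V : Set H) = {v | p.proj n v = v} := by
      ext v
      exact ⟨hid v, fun h => ⟨v, h⟩⟩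
    rw [this]
    exact isClosed_eq (p.proj n).continuous continuous_id
  have h2 := IsCompactOperator.restrict (f := (p.proj n).toLinearMap) h (V := V)
    (fun v hv => by change p.proj n v ∈ V; rw [hid v hv]; exact hv) hc
  refine FiniteDimensional.of_isCompactOperator_id (𝕜 := ℂ) (E := V) ?_
  have h3 : (id : V → V) = (p.proj n).toLinearMap.restrict
      (fun v hv => by change p.proj n v ∈ V; rw [hid v hv]; exact hv) :=
    funext fun v => Subtype.ext (hid v v.2).symm
  rw [h3]
  exact h2

theorem norm_apply_le {f : C₀(plankS, ℂ)} {k : H →L[ℂ] H} (hk : IsCompactOperator k) (n : ℕ) :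
    ‖f (sPoint n)‖ ≤ ‖p.rho f + k‖ := by
  by_contra! hlt
  set c := f (sPoint n)
  set P := p.proj n
  have hPP : P * P = P := (p.isStarProjection n).isIdempotentElem.eq
  have hP1 : ‖P‖ ≤ 1 := (p.isStarProjection n).norm_le
  have hc : c ≠ 0 := fun h => by
    rw [h, norm_zero] at hlt
    exact (norm_nonneg _).not_gt hlt
  set M : H →L[ℂ] H := c⁻¹ • (P * (p.rho f + k) * P) with hM
  have hM1 : ‖M‖ < 1 := by
    have : ‖P * (p.rho f + k) * P‖ ≤ ‖p.rho f + k‖ := by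
      calc _ ≤ ‖P‖ * ‖p.rho f + k‖ * ‖P‖ := (norm_mul_le _ _).trans (by gcongr; exact norm_mul_le _ _)
        _ ≤ 1 * ‖p.rho f + k‖ * 1 := by gcongr
        _ = _ := by ring
    rw [hM, norm_smul, norm_inv, inv_mul_lt_iff₀ (norm_pos_iff.2 hc), mul_one]
    exact this.trans_lt hlt
  have hMP : c • M = c • P + P * k * P := by
    rw [hM, smul_inv_smul₀ hc, mul_add, add_mul, p.proj_mul_rho, smul_mul_assoc]
    change c • (P * P) + _ = _
    rw [hPP]
  have hMM : M * P = M := by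
    rw [hM, smul_mul_assoc, mul_assoc _ P P, hPP]
  let u := Units.oneSub M hM1
  have hu : (u : H →L[ℂ] H) * P = -(c⁻¹ • (P * k * P)) := by
    have h1 : (u : H →L[ℂ] H) = 1 - M := rfl
    have h2 : P * k * P = c • M - c • P := by rw [hMP]; abel
    rw [h1, sub_mul, one_mul, hMM, h2, smul_sub, inv_smul_smul₀ hc, inv_smul_smul₀ hc]
    abel
  have hP : P = ((↑u⁻¹ : H →L[ℂ] H) * -(c⁻¹ • P)) * k * P := by
    have : P = (↑u⁻¹ : H →L[ℂ] H) * ((u : H →L[ℂ] H) * P) := by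
      rw [← mul_assoc, Units.inv_mul, one_mul]
    conv_lhs => rw [this, hu]
    simp only [mul_neg, neg_mul, mul_smul_comm, smul_mul_assoc, mul_assoc]
  apply p.not_isCompactOperator_proj n
  change IsCompactOperator P
  rw [hP]
  exact (hk.clm_comp ((↑u⁻¹ : H →L[ℂ] H) * -(c⁻¹ • P))).comp_clm P

theorem norm_le_norm_rho_add {f : C₀(plankS, ℂ)} {k : H →L[ℂ] H} (hk : IsCompactOperator k) :
    ‖f‖ ≤ ‖p.rho f + k‖ := by
  rw [← ZeroAtInftyContinuousMap.norm_toBCF_eq_norm,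
    BoundedContinuousFunction.norm_le (norm_nonneg _)]
  intro s
  obtain ⟨n, rfl⟩ := sPoint_surjective s
  exact p.norm_apply_le hk n

end ProjSeq

theorem isCompactOperator_star {T : H →L[ℂ] H} (hT : IsCompactOperator T) :
    IsCompactOperator (star T : H →L[ℂ] H) := by
  have hTT : IsCompactOperator (T * star T : H →L[ℂ] H) := hT.comp_clm (star T)
  refine (isCompactOperator_iff_isCompact_closure_image_closedBall (𝕜₁ := ℂ)
    ((star T : H →L[ℂ] H).toLinearMap) one_pos).2 ?_
  have htb : TotallyBounded ((T * star T : H →L[ℂ] H) '' Metric.closedBall 0 1) :=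
    (hTT.isCompact_closure_image_closedBall (f := (T * star T : H →L[ℂ] H).toLinearMap)
      1).totallyBounded.subset subset_closure
  refine isCompact_iff_totallyBounded_isComplete.2 ⟨TotallyBounded.closure ?_, isClosed_closure.isComplete⟩
  rw [Metric.totallyBounded_iff]
  intro ε hε
  obtain ⟨t, ht, htf, hcov⟩ := Metric.finite_approx_of_totallyBounded htb (ε ^ 2 / 2) (by positivity)
  obtain ⟨s', hs', hs'f, rfl⟩ : ∃ s' ⊆ Metric.closedBall (0 : H) 1, s'.Finite ∧
      (T * star T : H →L[ℂ] H) '' s' = t :=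
    by
    obtain ⟨s, h1, h2, h3⟩ := exists_subset_image_finite_and.1 ⟨t, ht, htf, rfl⟩
    exact ⟨s, h1, h2, h3.symm⟩
  refine ⟨(star T : H →L[ℂ] H) '' s', hs'f.image _, ?_⟩
  rintro _ ⟨x, hx, rfl⟩
  have := hcov ⟨x, hx, rfl⟩
  simp only [mem_iUnion, mem_image, exists_prop, exists_exists_and_eq_and, Metric.mem_ball,
    dist_eq_norm] at this ⊢
  obtain ⟨y, hy, hxy⟩ := this
  refine ⟨y, hy, ?_⟩
  change ‖(star T : H →L[ℂ] H) x - (star T : H →L[ℂ] H) y‖ < ε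
  rw [← map_sub] at hxy ⊢
  have hn : ‖x - y‖ ≤ 2 := by
    have h1 : ‖x‖ ≤ 1 := by simpa using hx
    have h2 : ‖y‖ ≤ 1 := by simpa using hs' hy
    linarith [norm_sub_le x y]
  refine lt_of_pow_lt_pow_left₀ 2 hε.le ?_
  rw [← inner_self_eq_norm_sq (𝕜 := ℂ), ContinuousLinearMap.star_eq_adjoint,
    ContinuousLinearMap.adjoint_inner_left, ← ContinuousLinearMap.star_eq_adjoint,
    ← mul_apply_eq_comp]
  calc _ ≤ ‖x - y‖ * ‖(T * star T : H →L[ℂ] H) (x - y)‖ :=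
        (Complex.re_le_norm _).trans (norm_inner_le_norm _ _)
    _ ≤ 2 * ‖(T * star T : H →L[ℂ] H) (x - y)‖ := by gcongr
    _ < ε ^ 2 := by linarith

namespace ProjSeq

variable (p : ProjSeq H)

/-- `E = ρ(D) + K(H)`, where `K(H)` is the ideal of compact operators. -/
noncomputable def algE : NonUnitalStarSubalgebra ℂ (H →L[ℂ] H) where
  carrier := {e | ∃ (d : C₀(plankS, ℂ)) (k : H →L[ℂ] H), IsCompactOperator k ∧ e = p.rho d + k}
  add_mem' := by
    rintro _ _ ⟨d, k, hk, rfl⟩ ⟨d', k', hk', rfl⟩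
    exact ⟨d + d', k + k', hk.add hk', by rw [map_add]; abel⟩
  zero_mem' := ⟨0, 0, isCompactOperator_zero, by simp⟩
  mul_mem' := by
    rintro _ _ ⟨d, k, hk, rfl⟩ ⟨d', k', hk', rfl⟩
    refine ⟨d * d', p.rho d * k' + k * (p.rho d' + k'),
      (hk'.clm_comp (p.rho d)).add (hk.comp_clm (p.rho d' + k')), ?_⟩
    rw [map_mul]; noncomm_ring
  smul_mem' := by
    rintro c _ ⟨d, k, hk, rfl⟩
    exact ⟨c • d, c • k, hk.smul c, by rw [map_smul, smul_add]⟩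
  star_mem' := by
    rintro _ ⟨d, k, hk, rfl⟩
    exact ⟨star d, star k, isCompactOperator_star hk, by rw [map_star, star_add]⟩

theorem exists_decomp (e : p.algE) : ∃ d : C₀(plankS, ℂ), IsCompactOperator (e.1 - p.rho d) := by
  obtain ⟨d, k, hk, h⟩ := e.2
  exact ⟨d, by rw [h]; simpa using hk⟩

/-- The `d ∈ D`, unique by `quotFun_eq`, for which `e - ρ(d)` is compact. -/
noncomputable def quotFun (e : p.algE) : C₀(plankS, ℂ) := (p.exists_decomp e).choose

theorem quotFun_spec (e : p.algE) : IsCompactOperator (e.1 - p.rho (p.quotFun e)) :=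
  (p.exists_decomp e).choose_spec

theorem quotFun_eq {e : p.algE} {d : C₀(plankS, ℂ)} (h : IsCompactOperator (e.1 - p.rho d)) :
    p.quotFun e = d := by
  have h1 := h.sub (p.quotFun_spec e)
  have h2 := p.norm_le_norm_rho_add (f := p.quotFun e - d)
    (k := -((e.1 - p.rho d) - (e.1 - p.rho (p.quotFun e)))) h1.neg
  rw [map_sub] at h2
  have h3 : p.rho (p.quotFun e) - p.rho d +
      -((e.1 - p.rho d) - (e.1 - p.rho (p.quotFun e))) = 0 := by abel
  rw [h3, norm_zero] at h2
  exact sub_eq_zero.1 (norm_le_zero_iff.1 h2)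

/-- The natural quotient map `π₂ : E → D`, `ρ(d) + k ↦ d` (its kernel is `K(H)`). -/
noncomputable def quotMap : p.algE →⋆ₙₐ[ℂ] C₀(plankS, ℂ) where
  toFun := p.quotFun
  map_smul' c e := p.quotFun_eq (by
    have := (p.quotFun_spec e).smul c
    rwa [← FunLike.coe_smul, smul_sub, ← map_smul] at this)
  map_zero' := p.quotFun_eq (by simpa using isCompactOperator_zero)
  map_add' e e' := p.quotFun_eq (by
    have := (p.quotFun_spec e).add (p.quotFun_spec e')
    rwa [← FunLike.coe_add, sub_add_sub_comm, ← map_add] at this)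
  map_mul' e e' := p.quotFun_eq (by
    have h1 : IsCompactOperator (p.rho (p.quotFun e) * (e'.1 - p.rho (p.quotFun e')) +
        (e.1 - p.rho (p.quotFun e)) * e'.1 : H →L[ℂ] H) :=
      ((p.quotFun_spec e').clm_comp (p.rho (p.quotFun e))).add
        ((p.quotFun_spec e).comp_clm e'.1)
    have h2 : (e * e').1 - p.rho (p.quotFun e * p.quotFun e') =
        p.rho (p.quotFun e) * (e'.1 - p.rho (p.quotFun e')) +
          (e.1 - p.rho (p.quotFun e)) * e'.1 := by
      rw [map_mul]
      change e.1 * e'.1 - _ = _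
      noncomm_ring
    rwa [h2])
  map_star' e := p.quotFun_eq (by
    have := isCompactOperator_star (p.quotFun_spec e)
    rwa [star_sub, ← map_star] at this)

theorem quotMap_eq_iff {e : p.algE} {d : C₀(plankS, ℂ)} :
    p.quotMap e = d ↔ IsCompactOperator (e.1 - p.rho d) :=
  ⟨fun h => h ▸ p.quotFun_spec e, p.quotFun_eq⟩

instance isClosed_algE : IsClosed (p.algE : Set (H →L[ℂ] H)) := by
  have hb : ∀ e : p.algE, ‖p.quotMap e‖ ≤ ‖e‖ := fun e => by
    have := p.norm_le_norm_rho_add (f := p.quotFun e) (p.quotFun_spec e)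
    rwa [add_sub_cancel] at this
  have hcont : UniformContinuous p.quotMap :=
    (AddMonoidHomClass.lipschitz_of_bound p.quotMap 1 (by simpa using hb)).uniformContinuous
  refine IsComplete.isClosed ?_
  rw [← completeSpace_coe_iff_isComplete]
  refine Metric.complete_of_cauchySeq_tendsto fun u hu => ?_
  obtain ⟨d, hd⟩ := cauchySeq_tendsto_of_complete (hcont.comp_cauchySeq hu)
  obtain ⟨e, he⟩ := cauchySeq_tendsto_of_complete
    (uniformContinuous_subtype_val.comp_cauchySeq hu)
  have hk : IsCompactOperator (e - p.rho d) := by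
    refine isCompactOperator_of_tendsto (F := fun n => (u n).1 - p.rho (p.quotMap (u n)))
      (l := atTop) ?_ (Eventually.of_forall fun n => p.quotFun_spec (u n))
    exact he.sub (((map_continuous p.rho).tendsto d).comp hd)
  exact ⟨⟨e, d, _, hk, by abel⟩, tendsto_subtype_rng.2 he⟩

/-- The pullback `A = {(b,e) ∈ B ⊕ E | π₁(b) = π₂(e)}`. -/
noncomputable def algA : NonUnitalStarSubalgebra ℂ (C₀(Plank, ℂ) × p.algE) :=
  NonUnitalStarAlgHom.equalizer
    (restrictS.comp (NonUnitalStarAlgHom.fst ℂ C₀(Plank, ℂ) p.algE))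
    (p.quotMap.comp (NonUnitalStarAlgHom.snd ℂ C₀(Plank, ℂ) p.algE))

theorem mem_algA {x : C₀(Plank, ℂ) × p.algE} :
    x ∈ p.algA ↔ restrictS x.1 = p.quotMap x.2 := Iff.rfl

instance isClosed_algA : IsClosed (p.algA : Set (C₀(Plank, ℂ) × p.algE)) :=
  isClosed_eq ((map_continuous restrictS).comp continuous_fst)
    ((map_continuous p.quotMap).comp continuous_snd)

/-- The subset `K = T ∪ {z}` of `Glimm(A)`, where `Prim(A)` is identified with `X` by `φ`: the image
of `T ∪ {y}` under `q_A` (and `z` is the image of `y`). -/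
def setK (p : ProjSeq H) (φ : SpaceX ≃ₜ Prim p.algA) : Set (Glimm p.algA) :=
  (fun x => glimmMap (φ x)) '' (SpaceX.emb '' plankT ∪ {SpaceX.extra})

end ProjSeq

end Algebra

end GlimmSpace

namespace GlimmSpace

open Set Filter Topology
open scoped Ordinal ZeroAtInfty CStarAlgebra

/-! ### The Tychonoff plank `Y` and the space `X`. -/

section Topology

/-! The pairs `(0,k)` with `k` compact form an ideal of `A`, and `b ↦ (b, ρ(π₁ b))` splits the
quotient `A → B`. So a primitive ideal of `A` either contains this ideal and is then prime over
`C₀(Y)`, which makes it the kernel of evaluation at a point (`exists_mem_iff_of_forall_ofK_mem`), or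
it does not, and then rank-one operators force it to be `{e = 0}` (`mem_iff_of_ofK_notMem`). The
topology matches that of `X` because `e = 0` forces `b` to vanish on `S`, so that `S` lies in the
closure of `y` (`exists_homeomorph_prim`).

A continuous real function on `X` is constant on the closure `S ∪ {y}` of `y`, while bump functions
supported off `S` separate all other points. Hence `S ∪ {y}` is the only nontrivial class, with
Glimm ideal `{e = 0}`.

Compactness of `K` for `τ_cr` is the Tychonoff plank argument (`eventually_const_on_plankT`). A
continuous function that equals `c` on `S` equals `c` on each row `[0,Ω] × {n}` beyond a countable
ordinal. The supremum of these countably many ordinals is still below `Ω`, and continuity in the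
second coordinate carries the value `c` to the tail of `T`. Thus the functions defining `τ_cr` see
the points of `T` converge to the class of `y`, and `K` is a continuous image of `[0,Ω]`. For `τ_q`
more sets are open: deleting a tail of `T` from `X` leaves a saturated open set, and these sets give
an increasing cover of `K` with no finite subcover.

Finally, at a point `t` of `T` the norm in the Glimm quotient is at most `|b(t)|`. A bound `α > 0`
from below on `K` would put `T` into the compact set `{|b| ≥ α}`, but `T` lies in no compact subset
of `Y`. -/

instance compactSpace_Iic_ordinal (a : Ordinal) : CompactSpace (Iic a) :=
  isCompact_iff_compactSpace.1 (by rw [← Icc_bot]; exact isCompact_Icc)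

instance locallyCompactSpace_plank : LocallyCompactSpace Plank :=
  (isOpen_compl_singleton (x := ((⊤, ⊤) : Iic (ω_ 1 : Ordinal.{0}) × Iic (ω : Ordinal.{0}))
    )).isOpenEmbedding_subtypeVal.locallyCompactSpace

theorem isClosed_plankT : IsClosed plankT :=
  isClosed_eq (continuous_snd.comp continuous_subtype_val) continuous_const

theorem notMem_plankS_of_mem_plankT {x : Plank} (h : x ∈ plankT) : x ∉ plankS :=
  fun h' => x.2 (Prod.ext h' h)

theorem SpaceX.isOpen_image_emb {U : Set Plank} (hU : IsOpen U) (h : Disjoint U plankS) :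
    IsOpen (SpaceX.emb '' U) := by
  refine ⟨by rwa [preimage_image_eq _ SpaceX.isEmbedding_emb.injective], ?_⟩
  rintro ⟨s, hs, u, hu, hus⟩
  exact (disjoint_left.1 h hu (SpaceX.emb.inj hus ▸ hs)).elim

theorem SpaceX.isOpen_insert_image_emb {U : Set Plank} (hU : IsOpen U) :
    IsOpen (insert SpaceX.extra (SpaceX.emb '' U)) := by
  refine ⟨?_, fun _ => Or.inl rfl⟩
  convert hU using 1
  ext x
  simp

/-- Every neighbourhood of a point of `S` contains `y`, so there `y` is added to a compact
neighbourhood in `Y`. Off the closed set `S`, a compact neighbourhood in `Y` that misses `S` serves,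
and `y` itself is isolated. -/
instance locallyCompactSpace_spaceX : LocallyCompactSpace SpaceX := by
  refine ⟨fun x N hN => ?_⟩
  obtain ⟨U, hUN, hU, hxU⟩ := mem_nhds_iff.1 hN
  rcases x with x | _
  · by_cases hx : x ∈ plankS
    · obtain ⟨C, hC, hCU, hCc⟩ := local_compact_nhds (hU.1.mem_nhds hxU)
      refine ⟨insert SpaceX.extra (SpaceX.emb '' C), ?_, ?_,
        (hCc.image SpaceX.isEmbedding_emb.continuous).insert _⟩
      · exact mem_of_superset ((SpaceX.isOpen_insert_image_emb isOpen_interior).mem_nhds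
          (Or.inr ⟨x, mem_interior_iff_mem_nhds.2 hC, rfl⟩))
          (insert_subset_insert (image_mono interior_subset))
      · refine insert_subset (hUN (hU.2 ⟨x, hx, hxU⟩)) ?_
        exact (image_subset_iff.2 hCU).trans hUN
    · obtain ⟨C, hC, hCU, hCc⟩ := local_compact_nhds
        ((hU.1.inter isClosed_plankS.isOpen_compl).mem_nhds ⟨hxU, hx⟩)
      refine ⟨SpaceX.emb '' C, ?_, ?_, hCc.image SpaceX.isEmbedding_emb.continuous⟩
      · refine mem_of_superset ((SpaceX.isOpen_image_emb isOpen_interior ?_).mem_nhds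
          ⟨x, mem_interior_iff_mem_nhds.2 hC, rfl⟩) (image_mono interior_subset)
        exact disjoint_left.2 fun z hz hzS => (hCU (interior_subset hz)).2 hzS
      · exact (image_subset_iff.2 (hCU.trans inter_subset_left)).trans hUN
  · exact ⟨{SpaceX.extra}, SpaceX.isOpen_extra.mem_nhds rfl, by
      rintro _ rfl; exact hUN hxU, isCompact_singleton⟩

instance t0Space_spaceX : T0Space SpaceX := by
  refine ⟨fun x y h => ?_⟩
  have hextra : ∀ z, Inseparable SpaceX.extra z → z = SpaceX.extra := fun z hz =>
    (hz.mem_open_iff SpaceX.isOpen_extra).1 rfl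
  rcases x with x | _
  · rcases y with y | _
    · exact congrArg _ (SpaceX.isEmbedding_emb.isInducing.inseparable_iff.1 h).eq
    · exact hextra _ h.symm
  · exact (hextra _ h).symm

/-- A compactly supported continuous bump function at a point. -/
theorem exists_bump {X : Type*} [TopologicalSpace X] [T2Space X] [LocallyCompactSpace X] {U : Set X}
    (hU : IsOpen U) {x : X} (hx : x ∈ U) :
    ∃ f : C(X, ℝ), f x = 1 ∧ (∀ z ∉ U, f z = 0) ∧ HasCompactSupport f ∧ ∀ z, f z ∈ Icc 0 1 := by
  obtain ⟨f, h1, h2, h3, h4⟩ := exists_continuous_one_zero_of_isCompact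
    (isCompact_singleton (x := x)) hU.isClosed_compl
    (disjoint_left.2 fun z hz hz' => hz' (by rwa [mem_singleton_iff.1 hz]))
  exact ⟨f, h1 rfl, fun z hz => h2 hz, h3, h4⟩

/-- A bump function at a point, as an element of `C₀(X, ℂ)`. -/
theorem exists_bump_zeroAtInfty {X : Type*} [TopologicalSpace X] [T2Space X] [LocallyCompactSpace X]
    {U : Set X} (hU : IsOpen U) {x : X} (hx : x ∈ U) :
    ∃ f : C₀(X, ℂ), f x = 1 ∧ (∀ z ∉ U, f z = 0) ∧ ∀ z, ‖f z‖ ≤ 1 := by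
  obtain ⟨f, h1, h2, h3, h4⟩ := exists_bump hU hx
  refine ⟨⟨⟨fun z => (f z : ℂ), by fun_prop⟩, ?_⟩, ?_, ?_, ?_⟩
  · exact (h3.comp_left Complex.ofReal_zero).is_zero_at_infty
  · change ((f x : ℝ) : ℂ) = 1
    rw [h1, Complex.ofReal_one]
  · intro z hz
    change ((f z : ℝ) : ℂ) = 0
    rw [h2 z hz, Complex.ofReal_zero]
  · intro z
    change ‖((f z : ℝ) : ℂ)‖ ≤ 1
    rw [Complex.norm_real, Real.norm_of_nonneg (h4 z).1]
    exact (h4 z).2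

/-- Points of `S` lie in the closure of `y`, and the closure of a single value in a T1 space is that
value. -/
theorem SpaceX.apply_emb_eq_apply_extra {Z : Type*} [TopologicalSpace Z] [T1Space Z]
    {f : SpaceX → Z} (hf : Continuous f) {s : Plank} (hs : s ∈ plankS) :
    f (SpaceX.emb s) = f SpaceX.extra := by
  have h : SpaceX.emb s ∈ closure {SpaceX.extra} := by
    rw [SpaceX.closure_extra]; exact Or.inr ⟨s, hs, rfl⟩
  have := image_closure_subset_closure_image hf ⟨_, h, rfl⟩
  simpa using this

/-- The extension to `X`, by zero at the additional point, of a function on `Y`. -/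
def SpaceX.extend (g : Plank → ℝ) : SpaceX → ℝ
  | SpaceX.emb x => g x
  | SpaceX.extra => 0

theorem SpaceX.continuous_extend {g : Plank → ℝ} (hg : Continuous g) (h : ∀ s ∈ plankS, g s = 0) :
    Continuous (SpaceX.extend g) := by
  refine ⟨fun V hV => ⟨hV.preimage hg, ?_⟩⟩
  rintro ⟨s, hs, hsV⟩
  change g s ∈ V at hsV
  change (0 : ℝ) ∈ V
  rwa [← h s hs]

/-- A bump on `Y` supported off `S` vanishes on `S`, so its extension by zero to `y` is continuous
on `X`. -/
theorem SpaceX.exists_separating {x : Plank} (hx : x ∉ plankS) {x' : SpaceX}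
    (h : SpaceX.emb x ≠ x') :
    ∃ f : SpaceX → ℝ, Continuous f ∧ (∀ z, |f z| ≤ 1) ∧ f (SpaceX.emb x) ≠ f x' := by
  obtain ⟨U, hU, hxU, hUS, hx'⟩ : ∃ U : Set Plank, IsOpen U ∧ x ∈ U ∧ Disjoint U plankS ∧
      ∀ z ∈ U, SpaceX.emb z ≠ x' := by
    rcases x' with x' | _
    · refine ⟨plankSᶜ \ {x'}, isClosed_plankS.isOpen_compl.sdiff isClosed_singleton,
        ⟨hx, fun h' => h (congrArg _ h')⟩, ?_, ?_⟩
      · exact disjoint_left.2 fun z hz => hz.1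
      · exact fun z hz hz' => hz.2 (SpaceX.emb.inj hz')
    · exact ⟨plankSᶜ, isClosed_plankS.isOpen_compl, hx, disjoint_compl_left, by simp⟩
  obtain ⟨g, h1, h2, -, h4⟩ := exists_bump hU hxU
  refine ⟨SpaceX.extend g, SpaceX.continuous_extend g.continuous
    (fun s hs => h2 s fun h' => disjoint_left.1 hUS h' hs), ?_, ?_⟩
  · rintro (z | _)
    · exact abs_le.2 ⟨by change -1 ≤ g z; linarith [(h4 z).1], (h4 z).2⟩
    · simp [SpaceX.extend]
  · have h0 : SpaceX.extend g x' = 0 := by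
      rcases x' with x' | _
      · exact h2 _ fun h' => hx' _ h' rfl
      · rfl
    change g x ≠ _
    rw [h0, h1]
    exact one_ne_zero

/-- The point `(β,ω)` of `T`. -/
def tPoint (β : Iic (ω_ 1 : Ordinal.{0})) (h : β ≠ ⊤) : Plank :=
  ⟨(β, ⊤), fun h' => h (Prod.mk.inj h').1⟩

theorem tPoint_mem (β : Iic (ω_ 1 : Ordinal.{0})) (h : β ≠ ⊤) : tPoint β h ∈ plankT := rfl

theorem eq_tPoint {x : Plank} (hx : x ∈ plankT) :
    x = tPoint x.1.1 (notMem_plankS_of_mem_plankT hx) :=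
  Subtype.ext (Prod.ext rfl hx)

/-- If `a` is a limit ordinal, then `⊤` has no smallest neighbour in `[0,a]`. -/
theorem exists_between_top_of_isSuccLimit {a : Ordinal} (ha : Order.IsSuccLimit a)
    {β : Iic a} (h : β < ⊤) : ∃ γ : Iic a, β < γ ∧ γ < ⊤ :=
  ⟨⟨Order.succ β.1, (ha.succ_lt h).le⟩, Order.lt_succ β.1, ha.succ_lt h⟩

theorem exists_Ioi_subset_of_mem_nhds_top {a : Ordinal} (ha : Order.IsSuccLimit a)
    {N : Set (Iic a)} (hN : N ∈ 𝓝 ⊤) : ∃ β < (⊤ : Iic a), Ioi β ⊆ N := by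
  obtain ⟨β, hβ, h⟩ := exists_Ioc_subset_of_mem_nhds hN
    ⟨⟨⊥, mem_Iic.2 bot_le⟩, lt_of_le_of_ne le_top fun h => ha.ne_bot (congrArg Subtype.val h).symm⟩
  exact ⟨β, hβ, fun γ hγ => h ⟨hγ, le_top⟩⟩

theorem isSuccLimit_omega_one : Order.IsSuccLimit (ω_ 1 : Ordinal.{0}) :=
  Cardinal.isSuccLimit_omega 1

/-- A countable family in `[0,Ω)` is bounded. -/
theorem exists_forall_le_of_countable {ι : Type*} [Countable ι] (β : ι → Iic (ω_ 1 : Ordinal.{0}))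
    (h : ∀ i, β i < ⊤) : ∃ γ < (⊤ : Iic (ω_ 1 : Ordinal.{0})), ∀ i, β i ≤ γ := by
  have hlt : (⨆ i, (β i).1) < ω_ 1 := Ordinal.iSup_lt_omega_one fun i => h i
  refine ⟨⟨⨆ i, (β i).1, hlt.le⟩, hlt, fun i => ?_⟩
  exact le_ciSup (f := fun i => (β i).1) ⟨ω_ 1, by rintro _ ⟨i, rfl⟩; exact (β i).2⟩ i

/-- A continuous function on `Y` that is constant on `S` is eventually constant on `T`. -/
theorem eventually_const_on_plankT {f : Plank → ℝ} (hf : Continuous f) {c : ℝ}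
    (hc : ∀ s ∈ plankS, f s = c) : ∃ γ < (⊤ : Iic (ω_ 1 : Ordinal.{0})),
      ∀ x ∈ plankT, γ < x.1.1 → f x = c := by
  have hrow : ∀ (k : Iic (ω : Ordinal.{0})) (hk : k ≠ ⊤),
      ∃ γ < (⊤ : Iic (ω_ 1 : Ordinal.{0})), ∀ β, γ < β →
        f ⟨(β, k), fun h => hk (Prod.mk.inj h).2⟩ = c := by
    intro k hk
    let g : Iic (ω_ 1 : Ordinal.{0}) → ℝ := fun β => f ⟨(β, k), fun h => hk (Prod.mk.inj h).2⟩
    have hg : Continuous g := hf.comp (Continuous.subtype_mk (by fun_prop) _)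
    have hgt : g ⊤ = c := hc _ rfl
    -- One bound for each radius `1/(m+1)`. A common bound of countably many stays below `Ω`, and
    -- beyond it the distance to `c` is zero.
    choose γ hγ hγ' using fun m : ℕ => exists_Ioi_subset_of_mem_nhds_top isSuccLimit_omega_one
      (hg.continuousAt.preimage_mem_nhds (Metric.ball_mem_nhds (g ⊤)
        (Nat.one_div_pos_of_nat (n := m))))
    obtain ⟨δ, hδ, hle⟩ := exists_forall_le_of_countable γ hγ
    refine ⟨δ, hδ, fun β hβ => ?_⟩
    have hd : ∀ m : ℕ, dist (g β) c < 1 / ((m : ℝ) + 1) := fun m => by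
      rw [← hgt]; exact hγ' m ((hle m).trans_lt hβ)
    refine eq_of_dist_eq_zero (le_antisymm (le_of_forall_pos_le_add fun ε hε => ?_) dist_nonneg)
    obtain ⟨m, hm⟩ := exists_nat_one_div_lt hε
    linarith [hd m]
  have hk : ∀ n : ℕ, (⟨(n : Ordinal.{0}), (Ordinal.natCast_lt_omega0 n).le⟩ :
      Iic (ω : Ordinal.{0})) ≠ ⊤ := fun n h =>
    (Ordinal.natCast_lt_omega0 n).ne (congrArg Subtype.val h)
  choose γ hγ hγ' using fun n => hrow _ (hk n)
  obtain ⟨δ, hδ, hle⟩ := exists_forall_le_of_countable γ hγ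
  refine ⟨δ, hδ, fun x hx hxδ => ?_⟩
  have hx1 : x.1.1 ≠ ⊤ := notMem_plankS_of_mem_plankT hx
  let g : Iic (ω : Ordinal.{0}) → ℝ := fun k => f ⟨(x.1.1, k), fun h => hx1 (Prod.mk.inj h).1⟩
  have hg : Continuous g := hf.comp (Continuous.subtype_mk (by fun_prop) _)
  have hgx : f x = g ⊤ := by
    rw [eq_tPoint hx]; rfl
  -- If `f x ≠ c`, the same holds at `(β,n)` for some finite `n`, where `β` is the first coordinate
  -- of `x`, against the constancy of row `n` beyond `δ`.
  by_contra hne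
  rw [hgx] at hne
  obtain ⟨k, hk1, hk2⟩ := exists_Ioi_subset_of_mem_nhds_top Ordinal.isSuccLimit_omega0
    (hg.continuousAt.preimage_mem_nhds (isOpen_ne.mem_nhds hne))
  obtain ⟨l, hkl, hl⟩ := exists_between_top_of_isSuccLimit Ordinal.isSuccLimit_omega0 hk1
  obtain ⟨n, hn⟩ := Ordinal.lt_omega0.1 (show l.1 < ω from hl)
  refine hk2 hkl ?_
  have hl' : l = ⟨(n : Ordinal.{0}), (Ordinal.natCast_lt_omega0 n).le⟩ := Subtype.ext hn
  subst hl'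
  exact hγ' n _ ((hle n).trans_lt hxδ)

/-- The set `T` is not contained in a compact subset of `Y`. -/
theorem not_plankT_subset_of_isCompact {C : Set Plank} (hC : IsCompact C) : ¬ plankT ⊆ C := by
  intro h
  have hT : IsCompact plankT := hC.of_isClosed_subset isClosed_plankT h
  have hbot : (⟨⊥, mem_Iic.2 bot_le⟩ : Iic (ω_ 1 : Ordinal.{0})) ≠ ⊤ := fun h =>
    isSuccLimit_omega_one.ne_bot (congrArg Subtype.val h).symm
  -- A compact `T` would have a largest first coordinate, but `[0,Ω)` has no maximum.
  obtain ⟨β, ⟨x, hx, rfl⟩, hmax⟩ := (hT.image (f := fun x : Plank => x.1.1)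
    (continuous_fst.comp continuous_subtype_val)).exists_isGreatest ⟨_, _, tPoint_mem _ hbot, rfl⟩
  obtain ⟨γ, h1, h2⟩ := exists_between_top_of_isSuccLimit isSuccLimit_omega_one
    (lt_top_iff_ne_top.2 (notMem_plankS_of_mem_plankT hx))
  exact (hmax ⟨_, tPoint_mem γ h2.ne, rfl⟩).not_gt h1

end Topology

/-! ### Orthogonal projections, compact operators and operators of rank one. -/

section Operators

variable {H : Type*} [NormedAddCommGroup H] [InnerProductSpace ℂ H] [CompleteSpace H]

theorem exists_orthonormal_nat_prod (hH : ¬ FiniteDimensional ℂ H) :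
    ∃ e : ℕ × ℕ → H, Orthonormal ℂ e := by
  obtain ⟨w, b, -⟩ := exists_hilbertBasis ℂ H
  have hw : Infinite w := by
    by_contra h
    have : Finite w := not_infinite_iff_finite.1 h
    have := Fintype.ofFinite w
    exact hH b.toOrthonormalBasis.toBasis.finiteDimensional_of_finite
  refine ⟨b ∘ fun q => Infinite.natEmbedding w (Nat.pairEquiv q), b.orthonormal.comp _ ?_⟩
  exact (Infinite.natEmbedding w).injective.comp Nat.pairEquiv.injective

/-- Project onto the closed spans of the rows of a doubly indexed orthonormal family: distinct rows
are orthogonal and each row is infinite. -/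
theorem nonempty_projSeq (hH : ¬ FiniteDimensional ℂ H) : Nonempty (ProjSeq H) := by
  obtain ⟨e, he⟩ := exists_orthonormal_nat_prod hH
  let V : ℕ → Submodule ℂ H := fun n =>
    (Submodule.span ℂ (range fun k => e (n, k))).topologicalClosure
  have : ∀ n, CompleteSpace (V n) := fun n =>
    (Submodule.isClosed_topologicalClosure _).completeSpace_coe
  refine ⟨⟨fun n => (V n).starProjection, fun n => isStarProjection_starProjection, ?_, ?_⟩⟩
  · intro m n hmn
    refine Submodule.IsOrtho.starProjection_comp_starProjection ?_
    have h0 : Submodule.span ℂ (range fun k => e (m, k)) ⟂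
        Submodule.span ℂ (range fun k => e (n, k)) := by
      rw [Submodule.isOrtho_span]
      rintro _ ⟨k, rfl⟩ _ ⟨l, rfl⟩
      exact he.2 fun h => hmn (Prod.mk.inj h).1
    have h1 : V m ⟂ Submodule.span ℂ (range fun k => e (n, k)) :=
      Submodule.topologicalClosure_minimal _ h0 (Submodule.isClosed_orthogonal _)
    have h2 : V n ⟂ V m :=
      Submodule.topologicalClosure_minimal _ h1.symm (Submodule.isClosed_orthogonal _)
    exact h2.symm
  · intro n hfin
    have hr : LinearMap.range ((V n).starProjection).toLinearMap = V n :=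
      Submodule.range_starProjection _
    rw [hr] at hfin
    have hmem : ∀ k, e (n, k) ∈ V n := fun k =>
      Submodule.le_topologicalClosure _ (Submodule.subset_span ⟨k, rfl⟩)
    have hli : LinearIndependent ℂ fun k => (⟨e (n, k), hmem k⟩ : V n) := by
      refine LinearIndependent.of_comp (V n).subtype ?_
      exact (he.comp (fun k => (n, k)) fun _ _ h => (Prod.mk.inj h).2).linearIndependent
    exact not_finite_iff_infinite.2 inferInstance hli.finite

open InnerProductSpace in
/-- A closed additive group of operators that contains all operators of rank one contains all
compact operators. -/
theorem mem_of_isCompactOperator {M : AddSubgroup (H →L[ℂ] H)}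
    (hM : IsClosed (M : Set (H →L[ℂ] H))) (h : ∀ x y : H, rankOne ℂ x y ∈ M)
    {k : H →L[ℂ] H} (hk : IsCompactOperator k) : k ∈ M := by
  change k ∈ (M : Set (H →L[ℂ] H))
  rw [← hM.closure_eq, Metric.mem_closure_iff]
  intro ε hε
  have htb : TotallyBounded (k '' Metric.closedBall 0 1) :=
    (hk.isCompact_closure_image_closedBall (f := k.toLinearMap)
      1).totallyBounded.subset subset_closure
  obtain ⟨t, -, htf, hcov⟩ := Metric.finite_approx_of_totallyBounded htb (ε / 2) (half_pos hε)
  let V := Submodule.span ℂ t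
  have : FiniteDimensional ℂ V := FiniteDimensional.span_of_finite ℂ htf
  -- `V` is spanned by a finite `ε/2`-net of the image of the unit ball. The orthogonal projection
  -- gives the nearest point of `V`, hence moves each `k x` with `‖x‖ = 1` by at most `ε/2`; its
  -- composition with `k` is a finite sum of operators of rank one.
  refine ⟨V.starProjection ∘L k, ?_, ?_⟩
  · rw [(stdOrthonormalBasis ℂ V).starProjection_eq_sum_rankOne,
      ContinuousLinearMap.finsetSum_comp]
    refine sum_mem fun i _ => ?_
    rw [rankOne_comp]
    exact h _ _
  · rw [dist_eq_norm]
    refine lt_of_le_of_lt ?_ (half_lt_self hε)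
    refine ContinuousLinearMap.opNorm_le_of_unit_norm (half_pos hε).le fun x hx => ?_
    obtain ⟨y, hy, hxy⟩ := mem_iUnion₂.1 (hcov ⟨x, by simp [hx], rfl⟩)
    have hmin : ‖k x - V.starProjection (k x)‖ ≤ ‖k x - y‖ := by
      rw [Submodule.starProjection_minimal]
      exact ciInf_le ⟨0, by rintro _ ⟨_, rfl⟩; positivity⟩ (⟨y, Submodule.subset_span hy⟩ : V)
    exact hmin.trans (by simpa [dist_eq_norm] using (Metric.mem_ball.1 hxy).le)

omit [CompleteSpace H] in
open InnerProductSpace in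
theorem isCompactOperator_rankOne (x y : H) : IsCompactOperator (rankOne ℂ x y) := by
  rw [rankOne_def']
  have h : IsCompactOperator (innerSL ℂ y) :=
    isCompactOperator_of_locallyCompactSpace_dom (innerSL ℂ y)
  exact h.clm_comp (ContinuousLinearMap.toSpanSingleton ℂ x)

omit [CompleteSpace H] in
open InnerProductSpace in
/-- A subspace invariant under all operators of rank one is trivial. -/
theorem eq_bot_or_top_of_rankOne_mem {V : Submodule ℂ H}
    (h : ∀ x y : H, ∀ v ∈ V, rankOne ℂ x y v ∈ V) : V = ⊥ ∨ V = ⊤ := by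
  refine or_iff_not_imp_left.2 fun hV => ?_
  obtain ⟨v, hv, hv0⟩ := V.ne_bot_iff.1 hV
  refine Submodule.eq_top_iff'.2 fun x => ?_
  -- The rank-one operator given by `x` and `v` sends `v` to `⟨v,v⟩ x`.
  have h1 := V.smul_mem (inner ℂ v v)⁻¹ (h x v v hv)
  rwa [rankOne_apply, inv_smul_smul₀ (inner_self_ne_zero.2 hv0)] at h1

end Operators

/-- The type of `*`-homomorphisms between two C⋆-algebras. -/
abbrev CStarHom (A B : Type*) [NonUnitalCStarAlgebra A] [NonUnitalCStarAlgebra B] : Type _ :=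
  A →⋆ₙₐ[ℂ] B

/-! ### Kernels of `*`-homomorphisms on `C₀(X)`. -/

section FunctionAlgebra

variable {X : Type*} [TopologicalSpace X]

theorem isCompact_le_norm (f : C₀(X, ℂ)) {ε : ℝ} (hε : 0 < ε) : IsCompact {x | ε ≤ ‖f x‖} := by
  have h : ∀ᶠ x in cocompact X, ‖f x‖ < ε :=
    (tendsto_zero_iff_norm_tendsto_zero.1 f.zero_at_infty').eventually (gt_mem_nhds hε)
  obtain ⟨t, ht, hsub⟩ := mem_cocompact.1 h
  refine ht.of_isClosed_subset (isClosed_le continuous_const (map_continuous f).norm) fun x hx => ?_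
  by_contra hxt
  exact (show ε ≤ ‖f x‖ from hx).not_gt (hsub hxt)

/-- If a compact set contains no common zero of the kernel of a `*`-homomorphism on `C₀(X)`, then
the kernel contains a nonnegative function without zeros on that set. -/
theorem exists_nonneg_mem_ker {B : Type*} [NonUnitalCStarAlgebra B] (ψ : CStarHom C₀(X, ℂ) B)
    {K : Set X} (hK : IsCompact K) (h : ∀ x ∈ K, ∃ g, ψ g = 0 ∧ g x ≠ 0) :
    ∃ g, ψ g = 0 ∧ (∀ x, g x = (‖g x‖ : ℂ)) ∧ ∀ x ∈ K, g x ≠ 0 := by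
  refine hK.induction_on (p := fun s => ∃ g, ψ g = 0 ∧ (∀ x, g x = (‖g x‖ : ℂ)) ∧ ∀ x ∈ s, g x ≠ 0)
    ⟨0, map_zero _, by simp, by simp⟩ ?_ ?_ ?_
  · rintro s t hst ⟨g, h1, h2, h3⟩
    exact ⟨g, h1, h2, fun x hx => h3 x (hst hx)⟩
  · rintro s t ⟨g, h1, h2, h3⟩ ⟨g', h1', h2', h3'⟩
    -- Nonnegativity prevents cancellation, so the sum is nonzero wherever either summand is.
    have hn : ∀ x, (g + g') x = ((‖g x‖ + ‖g' x‖ : ℝ) : ℂ) := fun x => by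
      rw [Complex.ofReal_add, ← h2 x, ← h2' x]; rfl
    refine ⟨g + g', by rw [map_add, h1, h1', add_zero], fun x => ?_, fun x hx => ?_⟩
    · rw [hn, Complex.norm_real, Real.norm_of_nonneg (by positivity)]
    · rw [hn, Complex.ofReal_ne_zero]
      rcases hx with hx | hx
      · have := norm_pos_iff.2 (h3 x hx)
        positivity
      · have := norm_pos_iff.2 (h3' x hx)
        positivity
  · intro x hx
    obtain ⟨g, h1, h2⟩ := h x hx
    refine ⟨{z | g z ≠ 0}, mem_nhdsWithin_of_mem_nhds
      ((isOpen_ne_fun (map_continuous g) continuous_const).mem_nhds h2), star g * g,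
      by rw [map_mul, h1, mul_zero], fun z => ?_, fun z hz => mul_ne_zero (star_ne_zero.2 hz) hz⟩
    change star (g z) * g z = (‖star (g z) * g z‖ : ℂ)
    rw [CStarRing.norm_star_mul_self, Complex.star_def, ← Complex.normSq_eq_conj_mul_self,
      Complex.normSq_eq_norm_sq, sq]

/-- The kernel of a `*`-homomorphism on `C₀(X)` consists of the functions that vanish on the
common zeros of the kernel. -/
theorem map_eq_zero_of_forall_common_zero {B : Type*} [NonUnitalCStarAlgebra B]
    (ψ : CStarHom C₀(X, ℂ) B) {f : C₀(X, ℂ)}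
    (hf : ∀ x, (∀ g, ψ g = 0 → g x = 0) → f x = 0) : ψ f = 0 := by
  rw [← norm_le_zero_iff]
  refine le_of_forall_pos_le_add fun ε hε => ?_
  rw [zero_add]
  obtain ⟨g, hg, hgn, hgK⟩ := exists_nonneg_mem_ker ψ (isCompact_le_norm f hε) fun x hx => by
    by_contra! h
    have : f x = 0 := hf x h
    rw [mem_ofPred_eq, this, norm_zero] at hx
    exact hx.not_gt hε
  obtain ⟨c, hc, hcg⟩ := (isCompact_le_norm f hε).exists_forall_le'
    (f := fun x => ‖g x‖) (map_continuous g).norm.continuousOn (a := 0)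
    fun x hx => norm_pos_iff.2 (hgK x hx)
  -- Chosen so that `(‖f‖ + 1) * (δ / c) = ε`; the `+ 1` keeps the denominator positive when `f =
  -- 0`.
  set δ := ε * c / (‖f‖ + 1)
  have hδ : 0 < δ := by positivity
  have hden : ∀ x, ((‖g x‖ + δ : ℝ) : ℂ) ≠ 0 := fun x =>
    Complex.ofReal_ne_zero.2 (by positivity)
  -- Since `g` is nonnegative, `f - g * h = f * δ / (|g| + δ)`. This is at most `ε` in modulus:
  -- where `|f| ≥ ε` because `|g| ≥ c`, elsewhere because the factor is at most `1`. As `ψ` is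
  -- contractive and kills `g * h`, this bounds `ψ f`.
  let h : C₀(X, ℂ) := ⟨⟨fun x => f x / ((‖g x‖ + δ : ℝ) : ℂ),
    (map_continuous f).div (by have := map_continuous g; fun_prop) hden⟩, by
      refine squeeze_zero_norm (a := fun x => ‖f x‖ / δ) (fun x => ?_) ?_
      · change ‖f x / ((‖g x‖ + δ : ℝ) : ℂ)‖ ≤ _
        rw [norm_div, Complex.norm_real, Real.norm_of_nonneg (by positivity)]
        gcongr
        linarith [norm_nonneg (g x)]
      · simpa using (tendsto_zero_iff_norm_tendsto_zero.1 f.zero_at_infty').div_const δ⟩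
  have h1 : ψ f = ψ (f - g * h) := by rw [map_sub, map_mul, hg, zero_mul, sub_zero]
  rw [h1]
  refine (NonUnitalStarAlgHom.norm_apply_le ψ _).trans ?_
  rw [← ZeroAtInftyContinuousMap.norm_toBCF_eq_norm, BoundedContinuousFunction.norm_le hε.le]
  intro x
  have h2 : (f - g * h) x = f x * ((δ / (‖g x‖ + δ) : ℝ) : ℂ) := by
    change f x - g x * (f x / ((‖g x‖ + δ : ℝ) : ℂ)) = _
    have := hden x
    rw [Complex.ofReal_div, mul_div_assoc', mul_div_assoc', eq_div_iff this, sub_mul,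
      div_mul_cancel₀ _ this]
    push_cast
    linear_combination -(f x) * hgn x
  change ‖(f - g * h) x‖ ≤ ε
  rw [h2, norm_mul, Complex.norm_real, Real.norm_of_nonneg (by positivity)]
  by_cases hx : ε ≤ ‖f x‖
  · have hfx : ‖f x‖ ≤ ‖f‖ := by
      rw [← ZeroAtInftyContinuousMap.norm_toBCF_eq_norm]
      exact f.toBCF.norm_coe_le_norm x
    calc ‖f x‖ * (δ / (‖g x‖ + δ)) ≤ (‖f‖ + 1) * (δ / c) := by
          gcongr
          · linarith
          · linarith [hcg x hx]
      _ = ε := by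
          simp only [δ]
          field_simp
  · have : δ / (‖g x‖ + δ) ≤ 1 := (div_le_one (by positivity)).2 (by linarith [norm_nonneg (g x)])
    nlinarith [norm_nonneg (f x)]

end FunctionAlgebra

/-! ### Primitive ideals from irreducible representations and characters. -/

section Primitive

universe v w

/-- The linear isometry of a Hilbert space with its copy in a larger universe. -/
noncomputable def liftIsometry (H : Type v) [NormedAddCommGroup H] [InnerProductSpace ℂ H] :
    H ≃ₗᵢ[ℂ] PiLp 2 (fun _ : PUnit.{w + 1} => H) :=
  LinearIsometryEquiv.symm
    ⟨(PiLp.equivOfUnique 2 ℂ (fun _ : PUnit.{w + 1} => H)).toLinearEquiv, fun x => by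
      rw [PiLp.norm_eq_of_L2]
      simp only [Finset.univ_unique, Finset.sum_singleton]
      rw [Real.sqrt_sq (norm_nonneg _)]
      rfl⟩

variable {A : Type max w v} [NonUnitalCStarAlgebra A]
  {H : Type v} [NormedAddCommGroup H] [InnerProductSpace ℂ H] [CompleteSpace H]

variable (A H) in
/-- The type of representations of `A` on `H`. -/
abbrev Rep : Type _ := A →⋆ₙₐ[ℂ] (H →L[ℂ] H)

/-- `IsPrimitiveIdeal` asks for a Hilbert space in the universe of `A`, so the representation is
conjugated by the isometry onto a copy of `H` in that universe. -/
theorem isPrimitiveIdeal_ker {π : A →⋆ₙₐ[ℂ] (H →L[ℂ] H)} (hπ : IsIrreducibleRep π) :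
    IsPrimitiveIdeal (TwoSidedIdeal.ker π) := by
  let U := liftIsometry.{v, max w v} H
  let π' : A →⋆ₙₐ[ℂ] (PiLp 2 (fun _ : PUnit.{(max w v) + 1} => H) →L[ℂ]
      PiLp 2 (fun _ : PUnit.{(max w v) + 1} => H)) :=
    (U.conjStarAlgEquiv : _ →⋆ₙₐ[ℂ] _).comp π
  have hπ' : ∀ a x, π' a x = U (π a (U.symm x)) := fun a x => rfl
  have h0 : ∀ a, π' a = 0 ↔ π a = 0 := fun a =>
    map_eq_zero_iff U.conjStarAlgEquiv (EquivLike.injective U.conjStarAlgEquiv)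
  refine ⟨_, _, _, _, π', ⟨?_, fun V hV hinv => ?_⟩, ?_⟩
  · obtain ⟨a, ha⟩ := hπ.nonzero
    exact ⟨a, fun h => ha ((h0 a).1 h)⟩
  · let W : Submodule ℂ H := V.comap U.toLinearEquiv.toLinearMap
    have hW : ∀ v, v ∈ W ↔ U v ∈ V := fun v => Iff.rfl
    rcases hπ.irreducible W (hV.preimage U.continuous) (fun a v hv => by
        have := hinv a _ ((hW v).1 hv)
        rwa [hπ', U.symm_apply_apply] at this) with h | h
    · refine Or.inl (V.eq_bot_iff.2 fun x hx => ?_)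
      have : U.symm x ∈ W := by rwa [hW, U.apply_symm_apply]
      rw [h, Submodule.mem_bot] at this
      simpa using congrArg U this
    · refine Or.inr (Submodule.eq_top_iff'.2 fun x => ?_)
      have : U.symm x ∈ W := h ▸ Submodule.mem_top
      rwa [hW, U.apply_symm_apply] at this
  · ext a
    rw [TwoSidedIdeal.mem_ker, TwoSidedIdeal.mem_ker, h0]

/-- The kernel of a nonzero character is a primitive ideal. -/
theorem isPrimitiveIdeal_ker_character {A : Type w} [NonUnitalCStarAlgebra A] (χ : CStarHom A ℂ)
    (hχ : ∃ a, χ a ≠ 0) : IsPrimitiveIdeal (TwoSidedIdeal.ker χ) := by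
  let π : A →⋆ₙₐ[ℂ] (ℂ →L[ℂ] ℂ) :=
    { toFun := fun a => χ a • 1
      map_smul' := fun c a => by
        rw [map_smul, smul_assoc]; rfl
      map_zero' := by ext; simp
      map_add' := fun a b => by ext; simp
      map_mul' := fun a b => by rw [map_mul, smul_mul_smul_comm, one_mul]
      map_star' := fun a => by rw [map_star, star_smul, star_one] }
  have h0 : ∀ a, π a = 0 ↔ χ a = 0 := fun a =>
    ⟨fun h => by simpa [π] using DFunLike.congr_fun h 1, fun h => by ext; simp [π, h]⟩
  have h : IsIrreducibleRep π :=
    ⟨hχ.imp fun a ha h => ha ((h0 a).1 h), fun V _ _ => eq_bot_or_eq_top V⟩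
  have := isPrimitiveIdeal_ker h
  convert this using 1
  ext a
  rw [TwoSidedIdeal.mem_ker, TwoSidedIdeal.mem_ker, h0]

end Primitive

/-! ### The copies of `B` and `K(H)` in `A`, and the primitive ideal of each point of `X`. -/

namespace ProjSeq

variable {H : Type*} [NormedAddCommGroup H] [InnerProductSpace ℂ H] [CompleteSpace H]
  (p : ProjSeq H)

/-- The representation `ρ`, as a map into `E`. -/
noncomputable def rhoE : C₀(plankS, ℂ) →⋆ₙₐ[ℂ] p.algE :=
  NonUnitalStarAlgHom.codRestrict p.rho p.algE fun d => ⟨d, 0, isCompactOperator_zero, by simp⟩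

theorem coe_rhoE (d : C₀(plankS, ℂ)) : (p.rhoE d : H →L[ℂ] H) = p.rho d := rfl

theorem quotMap_rhoE (d : C₀(plankS, ℂ)) : p.quotMap (p.rhoE d) = d := by
  rw [quotMap_eq_iff, coe_rhoE, sub_self]
  exact isCompactOperator_zero

/-- The homomorphism `b ↦ (b, ρ(π₁ b))` from `B` to `A`. -/
noncomputable def ofB : CStarHom C₀(Plank, ℂ) p.algA :=
  NonUnitalStarAlgHom.codRestrict
    ((NonUnitalStarAlgHom.id ℂ C₀(Plank, ℂ)).prod (p.rhoE.comp restrictS)) p.algA fun b => by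
      rw [mem_algA]
      exact (p.quotMap_rhoE _).symm

variable {p} in
theorem quotMap_eq_zero_iff {e : p.algE} :
    p.quotMap e = 0 ↔ IsCompactOperator (e : H →L[ℂ] H) := by
  rw [quotMap_eq_iff, map_zero, sub_zero]

/-- The embedding `k ↦ (0, k)` of the compact operators into `A`. -/
noncomputable def ofK : compactOperator (RingHom.id ℂ) H H →+ p.algA where
  toFun k := ⟨(0, ⟨k.1, 0, k.1, k.2, by simp⟩), by
    rw [mem_algA, map_zero]
    exact (quotMap_eq_zero_iff.2 (show IsCompactOperator k.1 from k.2)).symm⟩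
  map_zero' := rfl
  map_add' k k' := Subtype.ext (Prod.ext (add_zero _).symm rfl)

theorem continuous_ofK : Continuous p.ofK :=
  Continuous.subtype_mk (continuous_const.prodMk (Continuous.subtype_mk continuous_subtype_val _)) _

variable {p} in
theorem algA_ext {a b : p.algA} (h1 : a.1.1 = b.1.1)
    (h2 : (a.1.2 : H →L[ℂ] H) = b.1.2) : a = b :=
  Subtype.ext (Prod.ext h1 (Subtype.ext h2))

variable {p} in
-- By the pullback condition, `π₁(b) = π₂(0) = 0`. This is the algebraic form of `S` lying in the
-- closure of `y`.
theorem apply_sPoint_eq_zero {a : p.algA} (h : a.1.2 = 0) {s : Plank} (hs : s ∈ plankS) :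
    a.1.1 s = 0 := by
  have h1 : restrictS a.1.1 = p.quotMap a.1.2 := p.mem_algA.1 a.2
  rw [h, map_zero] at h1
  exact DFunLike.congr_fun h1 (⟨s, hs⟩ : plankS)

theorem exists_eq_ofK {a : p.algA} (h : a.1.1 = 0) : ∃ k, a = p.ofK k := by
  have h1 : restrictS a.1.1 = p.quotMap a.1.2 := p.mem_algA.1 a.2
  rw [h, map_zero] at h1
  exact ⟨⟨a.1.2.1, quotMap_eq_zero_iff.1 h1.symm⟩, algA_ext h rfl⟩

/-- An operator of rank one, as a compact operator. -/
noncomputable def rankOneK (x y : H) : compactOperator (RingHom.id ℂ) H H :=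
  ⟨InnerProductSpace.rankOne ℂ x y, isCompactOperator_rankOne x y⟩

variable {p} in
/-- If the element `(0,k)` of `A` lies in the kernel of a `*`-homomorphism for all `k` of rank one,
then it does so for all compact operators `k`. -/
theorem map_ofK_eq_zero {C : Type*} [NonUnitalCStarAlgebra C] {π : CStarHom p.algA C}
    (h : ∀ x y : H, π (p.ofK (rankOneK x y)) = 0) (k : compactOperator (RingHom.id ℂ) H H) :
    π (p.ofK k) = 0 := by
  let F : compactOperator (RingHom.id ℂ) H H →+ C := (π : p.algA →+ C).comp p.ofK
  have hF : Continuous F := (map_continuous π).comp p.continuous_ofK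
  let M : AddSubgroup (H →L[ℂ] H) :=
    F.ker.map (compactOperator (RingHom.id ℂ) H H).subtype.toAddMonoidHom
  -- The kernel of `F` is closed among the compact operators, which are themselves closed among all
  -- bounded operators.
  have hM : IsClosed (M : Set (H →L[ℂ] H)) :=
    (isClosed_setOfPred_isCompactOperator.isClosedEmbedding_subtypeVal).isClosedMap _
      (isClosed_singleton.preimage hF)
  obtain ⟨k', hk', hkk⟩ := mem_of_isCompactOperator hM
    (fun x y => ⟨rankOneK x y, h x y, rfl⟩) k.2
  rw [← show k' = k from Subtype.ext hkk]
  exact hk'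

theorem exists_vector_ne_zero (p : ProjSeq H) : ∃ v : H, v ≠ 0 := by
  by_contra! h
  refine p.not_isCompactOperator_proj 0 ?_
  rw [show p.proj 0 = 0 from ContinuousLinearMap.ext fun v => h _]
  exact isCompactOperator_zero

/-- The elements of `A` that vanish at a point of `X`. -/
def VanishAt (a : p.algA) : SpaceX → Prop
  | SpaceX.emb x => a.1.1 x = 0
  | SpaceX.extra => a.1.2 = 0

/-- The character `(b,e) ↦ b(x)` of `A`. -/
noncomputable def character (x : Plank) : CStarHom p.algA ℂ where
  toFun a := a.1.1 x
  map_smul' _ _ := rfl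
  map_zero' := rfl
  map_add' _ _ := rfl
  map_mul' _ _ := rfl
  map_star' _ := rfl

/-- The representation `(b,e) ↦ e` of `A` on `H`. -/
noncomputable def repE : Rep p.algA H where
  toFun a := a.1.2.1
  map_smul' _ _ := rfl
  map_zero' := rfl
  map_add' _ _ := rfl
  map_mul' _ _ := rfl
  map_star' _ := rfl

theorem repE_ofK (k : compactOperator (RingHom.id ℂ) H H) : p.repE (p.ofK k) = k.1 := rfl

/-- The range contains all operators of rank one. -/
theorem isIrreducibleRep_repE : IsIrreducibleRep p.repE := by
  refine ⟨?_, fun V _ hV => eq_bot_or_top_of_rankOne_mem fun x y v hv => ?_⟩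
  · obtain ⟨v, hv⟩ := p.exists_vector_ne_zero
    refine ⟨p.ofK (rankOneK v v), ?_⟩
    rw [repE_ofK]
    exact InnerProductSpace.rankOne_ne_zero hv hv
  · have := hV (p.ofK (rankOneK x y)) v hv
    rwa [repE_ofK] at this

/-- Every point of `X` gives a primitive ideal. -/
theorem exists_prim_vanishAt (x : SpaceX) :
    ∃ P : Prim p.algA, ∀ a, a ∈ P.ideal ↔ p.VanishAt a x := by
  rcases x with x | _
  · have h : ∃ a, p.character x a ≠ 0 := by
      obtain ⟨f, hf, -⟩ := exists_bump_zeroAtInfty isOpen_univ (mem_univ x)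
      refine ⟨p.ofB f, ?_⟩
      rw [show p.character x (p.ofB f) = f x from rfl, hf]
      exact one_ne_zero
    exact ⟨⟨_, isPrimitiveIdeal_ker_character (p.character x) h⟩, fun a =>
      TwoSidedIdeal.mem_ker (p.character x)⟩
  · refine ⟨⟨_, isPrimitiveIdeal_ker p.isIrreducibleRep_repE⟩, fun a => ?_⟩
    refine (TwoSidedIdeal.mem_ker p.repE).trans ?_
    exact ZeroMemClass.coe_eq_zero

end ProjSeq

universe u in
/-- A primitive ideal is the kernel of a nonzero `*`-homomorphism. -/
theorem Prim.exists_mem_ideal_iff {A : Type u} [NonUnitalCStarAlgebra A] (P : Prim A) :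
    ∃ (C : Type u) (_ : NonUnitalCStarAlgebra C) (π : CStarHom A C),
      (∃ a, π a ≠ 0) ∧ ∀ a, a ∈ P.ideal ↔ π a = 0 := by
  obtain ⟨E, _, _, _, π, hπ, hP⟩ := P.2
  refine ⟨E →L[ℂ] E, inferInstance, π, hπ.nonzero, fun a => ?_⟩
  rw [Prim.ideal, hP]
  exact TwoSidedIdeal.mem_ker π

theorem Prim.mem_or_mem {A : Type*} [NonUnitalCStarAlgebra A] (P : Prim A) {a b : A}
    (h : ∀ x, a * x * b ∈ P.ideal) : a ∈ P.ideal ∨ b ∈ P.ideal :=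
  P.2.prime h

theorem Prim.mul_mul_mem {A : Type*} [NonUnitalCStarAlgebra A] (P : Prim A) {a : A}
    (h : a ∈ P.ideal) (b c : A) : b * a * c ∈ P.ideal :=
  P.ideal.mul_mem_right _ _ (P.ideal.mul_mem_left _ _ h)

/-! ### All primitive ideals of `A`, and the hull-kernel topology. -/

namespace ProjSeq

variable {H : Type*} [NormedAddCommGroup H] [InnerProductSpace ℂ H] [CompleteSpace H]
  (p : ProjSeq H)

/-- The extension of `B` by the compact operators splits through `ofB`. -/
theorem eq_ofB_add_ofK (a : p.algA) : ∃ k, a = p.ofB a.1.1 + p.ofK k := by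
  obtain ⟨k, hk⟩ := p.exists_eq_ofK (a := a - p.ofB a.1.1) (sub_self a.1.1)
  exact ⟨k, by rw [← hk]; abel⟩

/-- A primitive ideal that contains the compact operators is given by a point of `Y`. -/
theorem exists_mem_iff_of_forall_ofK_mem {P : Prim p.algA}
    (hK : ∀ k, p.ofK k ∈ P.ideal) : ∃ x : Plank, ∀ a, a ∈ P.ideal ↔ a.1.1 x = 0 := by
  obtain ⟨C, _, π, hπ, hP⟩ := P.exists_mem_ideal_iff
  let ψ : CStarHom C₀(Plank, ℂ) C := π.comp p.ofB
  have hmem : ∀ a : p.algA, a ∈ P.ideal ↔ ψ a.1.1 = 0 := by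
    intro a
    obtain ⟨k, hk⟩ := p.eq_ofB_add_ofK a
    have hk0 : π (p.ofK k) = 0 := (hP _).1 (hK k)
    rw [hP]
    conv_lhs => rw [hk, map_add, hk0, add_zero]
    rfl
  -- Without a common zero, `ψ` would kill all of `C₀(Y)`, and then `π` would be zero.
  obtain ⟨x, hx⟩ : ∃ x, ∀ g, ψ g = 0 → g x = 0 := by
    by_contra! h
    obtain ⟨a, ha⟩ := hπ
    refine ha ((hP a).1 ((hmem a).2
      (map_eq_zero_of_forall_common_zero ψ fun x hx => ?_)))
    obtain ⟨g, hg, hgx⟩ := h x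
    exact (hgx (hx g hg)).elim
  refine ⟨x, fun a => ⟨fun ha => hx _ ((hmem a).1 ha), fun ha => (hmem a).2
    (map_eq_zero_of_forall_common_zero ψ fun x' hx' => ?_)⟩⟩
  rcases eq_or_ne x' x with rfl | hne
  · exact ha
  -- A second common zero `x'` contradicts primeness: for bumps `f` at `x'` and `g` at `x` with
  -- disjoint supports, all products `f c g` have zero first component, yet neither bump lies in the
  -- ideal.
  · obtain ⟨U, V, hU, hV, hxU, hxV, hUV⟩ := t2_separation hne
    obtain ⟨f, hf1, hf0, -⟩ := exists_bump_zeroAtInfty hU hxU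
    obtain ⟨g, hg1, hg0, -⟩ := exists_bump_zeroAtInfty hV hxV
    have hfg : ∀ c : p.algA, (p.ofB f * c * p.ofB g).1.1 = 0 := by
      intro c
      ext z
      change f z * c.1.1 z * g z = 0
      by_cases hz : z ∈ U
      · rw [hg0 z (disjoint_left.1 hUV hz), mul_zero]
      · rw [hf0 z hz, zero_mul, zero_mul]
    rcases P.mem_or_mem (a := p.ofB f) (b := p.ofB g) (fun c => (hmem _).2 (by rw [hfg, map_zero])) with h | h
    · have := hx' f ((hmem _).1 h)
      rw [hf1] at this
      exact (one_ne_zero this).elim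
    · have := hx g ((hmem _).1 h)
      rw [hg1] at this
      exact (one_ne_zero this).elim

/-- A primitive ideal that does not contain all compact operators is `{(b,e) | e = 0}`. -/
theorem mem_iff_of_ofK_notMem {P : Prim p.algA}
    {k : compactOperator (RingHom.id ℂ) H H} (hk : p.ofK k ∉ P.ideal) (a : p.algA) :
    a ∈ P.ideal ↔ a.1.2 = 0 := by
  constructor
  · intro ha
    by_contra hne
    obtain ⟨v, hv⟩ : ∃ v, (a.1.2 : H →L[ℂ] H) v ≠ 0 := by
      by_contra! h
      exact hne (Subtype.ext (ContinuousLinearMap.ext h))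
    obtain ⟨C, _, π, -, hP⟩ := P.exists_mem_ideal_iff
    set u := (a.1.2 : H →L[ℂ] H) v
    have huu : inner ℂ u u ≠ 0 := inner_self_ne_zero.2 hv
    refine hk ((hP _).2 (map_ofK_eq_zero (fun x y => ?_) k))
    -- Sandwiching `a` between rank-one operators recovers any rank-one operator: `v` is sent by `e`
    -- to `u ≠ 0`, and the factor `⟨u,u⟩⁻¹` normalizes the result.
    have h1 : p.ofK (rankOneK x y) =
        p.ofK (rankOneK ((inner ℂ u u)⁻¹ • x) u) * a * p.ofK (rankOneK v y) := by
      refine algA_ext ?_ ?_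
      · ext z
        exact (mul_zero _).symm
      · ext z
        change inner ℂ y z • x = inner ℂ u ((a.1.2 : H →L[ℂ] H) (inner ℂ y z • v)) •
          (inner ℂ u u)⁻¹ • x
        rw [map_smul, inner_smul_right, smul_smul, mul_assoc, mul_inv_cancel₀ huu, mul_one]
    rw [← hP, h1]
    exact P.mul_mul_mem ha _ _
  · intro ha
    refine (P.mem_or_mem (a := a) (b := p.ofK k) fun c => ?_).resolve_right hk
    -- An element with `e = 0` annihilates the compact operators, so primeness puts it into `P`.
    have h0 : a * c * p.ofK k = 0 := by
      refine algA_ext ?_ ?_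
      · ext z
        exact mul_zero _
      · change (a.1.2 : H →L[ℂ] H) * c.1.2.1 * k.1 = 0
        rw [ha]
        simp
    rw [h0]
    exact zero_mem P.ideal

theorem exists_forall_mem_iff_vanishAt (P : Prim p.algA) :
    ∃ x, ∀ a, a ∈ P.ideal ↔ p.VanishAt a x := by
  by_cases h : ∀ k, p.ofK k ∈ P.ideal
  · obtain ⟨x, hx⟩ := p.exists_mem_iff_of_forall_ofK_mem h
    exact ⟨SpaceX.emb x, hx⟩
  · push Not at h
    obtain ⟨k, hk⟩ := h
    exact ⟨SpaceX.extra, p.mem_iff_of_ofK_notMem hk⟩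

/-- The condition on open sets at `S` holds because `b(s) ≠ 0` for some `s ∈ S` forces `e ≠ 0`. -/
theorem isClosed_vanishAt (a : p.algA) : IsClosed {x | p.VanishAt a x} := by
  rw [← isOpen_compl_iff]
  refine ⟨?_, ?_⟩
  · exact (isOpen_ne_fun (map_continuous a.1.1) continuous_const :
      IsOpen {x : Plank | a.1.1 x ≠ 0})
  · rintro ⟨s, hs, hsa⟩ h
    exact hsa (apply_sPoint_eq_zero h hs)

/-- At a point of `Y` a bump supported off `F` is lifted by `ofB`. If `y ∈ F`, then `S ⊆ F`, so the
bump restricts to zero on `S` and its lift vanishes at `y` too. At `y` a rank-one operator works. -/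
theorem exists_vanishAt_of_notMem {F : Set SpaceX} (hF : IsClosed F) {x : SpaceX} (hx : x ∉ F) :
    ∃ a, (∀ z ∈ F, p.VanishAt a z) ∧ ¬ p.VanishAt a x := by
  have hU := hF.isOpen_compl
  rcases x with x | _
  · obtain ⟨f, hf1, hf0, -⟩ := exists_bump_zeroAtInfty hU.1 (show x ∈ SpaceX.emb ⁻¹' Fᶜ from hx)
    refine ⟨p.ofB f, ?_, ?_⟩
    · rintro (z | _) hz
      · exact hf0 z fun h => h hz
      · have : restrictS f = 0 := by
          ext s
          exact hf0 _ fun h => hU.2 ⟨s, s.2, h⟩ hz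
        change p.rhoE (restrictS f) = 0
        rw [this, map_zero]
    · change f x ≠ 0
      rw [hf1]
      exact one_ne_zero
  · obtain ⟨v, hv⟩ := p.exists_vector_ne_zero
    refine ⟨p.ofK (rankOneK v v), ?_, fun h => ?_⟩
    · rintro (z | _) hz
      · exact rfl
      · exact (hx hz).elim
    · exact InnerProductSpace.rankOne_ne_zero hv hv (congrArg Subtype.val h)

theorem mem_of_forall_vanishAt {F : Set SpaceX} (hF : IsClosed F) {x : SpaceX}
    (h : ∀ a, (∀ z ∈ F, p.VanishAt a z) → p.VanishAt a x) : x ∈ F := by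
  by_contra hx
  obtain ⟨a, ha, hax⟩ := p.exists_vanishAt_of_notMem hF hx
  exact hax (h a ha)

/-- The identification of `X` with the primitive ideal space of `A`. -/
theorem exists_homeomorph_prim :
    ∃ φ : SpaceX ≃ₜ Prim p.algA, ∀ x a, a ∈ (φ x).ideal ↔ p.VanishAt a x := by
  choose f hf using p.exists_prim_vanishAt
  have hinj : Function.Injective f := by
    intro x x' h
    -- Points with the same ideal lie in each other's closure, so the T0 property identifies them.
    have hcl : ∀ {x x'}, f x = f x' → x ∈ closure {x'} := fun {x x'} h =>
      p.mem_of_forall_vanishAt isClosed_closure fun a ha => by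
        rw [← hf, h, hf]
        exact ha x' (subset_closure rfl)
    exact (inseparable_iff_mem_closure.2 ⟨hcl h, hcl h.symm⟩).eq
  have hsurj : Function.Surjective f := by
    intro P
    obtain ⟨x, hx⟩ := p.exists_forall_mem_iff_vanishAt P
    refine ⟨x, Subtype.ext (SetLike.ext fun a => ?_)⟩
    exact (hf x a).trans (hx a).symm
  have hcont : Continuous f := by
    refine continuous_iff_isClosed.2 fun F hF => ?_
    obtain ⟨I, rfl⟩ := isClosed_prim_iff.1 hF
    have : f ⁻¹' hull I = ⋂ a ∈ I, {x | p.VanishAt a x} := by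
      ext x
      simp only [mem_iInter, mem_ofPred_eq, ← hf]
      rfl
    rw [this]
    exact isClosed_biInter fun a _ => p.isClosed_vanishAt a
  have hclosed : IsClosedMap f := by
    intro F hF
    refine isClosed_prim_iff.2 ⟨sInf {I | ∃ x ∈ F, I = (f x).ideal}, ?_⟩
    refine Subset.antisymm ?_ ?_
    · rintro _ ⟨x, hx, rfl⟩
      exact fun a ha => (TwoSidedIdeal.mem_sInf _).1 ha _ ⟨x, hx, rfl⟩
    · intro P hP
      obtain ⟨x, rfl⟩ := hsurj P
      refine ⟨x, p.mem_of_forall_vanishAt hF fun a ha => ?_, rfl⟩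
      rw [← hf]
      refine hP ((TwoSidedIdeal.mem_sInf _).2 ?_)
      rintro _ ⟨z, hz, rfl⟩
      exact (hf z a).2 (ha z hz)
  exact ⟨(Equiv.ofBijective f ⟨hinj, hsurj⟩).toHomeomorphOfContinuousClosed hcont hclosed, hf⟩

end ProjSeq

/-! ### Glimm ideals, and the equivalence relation on `X`. -/

section Glimm

variable {A : Type*} [NonUnitalCStarAlgebra A]

theorem mem_glimmIdeal {P : Prim A} {a : A} :
    a ∈ glimmIdeal P ↔ ∀ Q, GlimmRel P Q → a ∈ Q.ideal := by
  rw [glimmIdeal, TwoSidedIdeal.mem_sInf]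
  exact ⟨fun h Q hQ => h _ ⟨Q, hQ, rfl⟩, by rintro h _ ⟨Q, hQ, rfl⟩; exact h Q hQ⟩

theorem glimmMap_eq_iff_ideal {P Q : Prim A} :
    glimmMap P = glimmMap Q ↔ glimmIdeal P = glimmIdeal Q :=
  Subtype.ext_iff

theorem Prim.ideal_injective : Function.Injective (Prim.ideal : Prim A → TwoSidedIdeal A) :=
  Subtype.val_injective

theorem quotientNorm_le_of_sub_mem {a c : A} {G : TwoSidedIdeal A} (h : c - a ∈ G) :
    quotientNorm a G ≤ ‖c‖ := by
  have h1 : quotientNorm a G ≤ ‖a + (c - a)‖ :=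
    ciInf_le ⟨0, by rintro _ ⟨_, rfl⟩; exact norm_nonneg _⟩ (⟨c - a, h⟩ : G)
  rwa [add_sub_cancel] at h1

end Glimm

theorem continuous_tPoint :
    Continuous fun β : ({⊤}ᶜ : Set (Iic (ω_ 1 : Ordinal.{0}))) => tPoint β.1 β.2 :=
  Continuous.subtype_mk (continuous_subtype_val.prodMk continuous_const) _

/-- The set `S ∪ {y}`. -/
def SpaceX.special : Set SpaceX := SpaceX.emb '' plankS ∪ {SpaceX.extra}

theorem SpaceX.extra_mem_special : SpaceX.extra ∈ SpaceX.special := Or.inr rfl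

theorem SpaceX.emb_mem_special_iff {x : Plank} : SpaceX.emb x ∈ SpaceX.special ↔ x ∈ plankS := by
  simp [SpaceX.special]

theorem SpaceX.apply_eq_apply_extra {Z : Type*} [TopologicalSpace Z] [T1Space Z]
    {f : SpaceX → Z} (hf : Continuous f) {x : SpaceX} (hx : x ∈ SpaceX.special) :
    f x = f SpaceX.extra := by
  rcases hx with ⟨s, hs, rfl⟩ | rfl
  · exact SpaceX.apply_emb_eq_apply_extra hf hs
  · rfl

/-- The equivalence relation on `X` whose only class with more than one point is `S ∪ {y}`. -/
def SpaceX.Rel (x x' : SpaceX) : Prop :=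
  x = x' ∨ (x ∈ SpaceX.special ∧ x' ∈ SpaceX.special)

open Classical in
/-- The representative of an equivalence class whose ideal is the Glimm ideal. -/
noncomputable def SpaceX.repr (x : SpaceX) : SpaceX :=
  if x ∈ SpaceX.special then SpaceX.extra else x

theorem SpaceX.rel_repr (x : SpaceX) : SpaceX.Rel x x.repr := by
  by_cases h : x ∈ SpaceX.special
  · rw [SpaceX.repr, if_pos h]
    exact Or.inr ⟨h, SpaceX.extra_mem_special⟩
  · rw [SpaceX.repr, if_neg h]
    exact Or.inl rfl

theorem SpaceX.rel_iff_repr_eq {x x' : SpaceX} : SpaceX.Rel x x' ↔ x.repr = x'.repr := by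
  constructor
  · rintro (rfl | ⟨h, h'⟩)
    · rfl
    · rw [SpaceX.repr, SpaceX.repr, if_pos h, if_pos h']
  · intro h
    by_cases hx : x ∈ SpaceX.special <;> by_cases hx' : x' ∈ SpaceX.special
    · exact Or.inr ⟨hx, hx'⟩
    · rw [SpaceX.repr, SpaceX.repr, if_pos hx, if_neg hx'] at h
      exact (hx' (h ▸ SpaceX.extra_mem_special)).elim
    · rw [SpaceX.repr, SpaceX.repr, if_neg hx, if_pos hx'] at h
      exact (hx (h ▸ SpaceX.extra_mem_special)).elim
    · rw [SpaceX.repr, SpaceX.repr, if_neg hx, if_neg hx'] at h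
      exact Or.inl h

/-- The set of the points of `X` that are not of the form `(γ,ω)` with `γ ≥ β`. -/
def SpaceX.coverSet (β : Iic (ω_ 1 : Ordinal.{0})) : Set SpaceX :=
  {x | ∀ t ∈ plankT, x = SpaceX.emb t → t.1.1 < β}

theorem SpaceX.isOpen_coverSet (β : Iic (ω_ 1 : Ordinal.{0})) :
    IsOpen (SpaceX.coverSet β) := by
  refine ⟨?_, fun _ t _ h => by simp at h⟩
  have : SpaceX.emb ⁻¹' SpaceX.coverSet β = plankTᶜ ∪ {x : Plank | x.1.1 < β} := by
    ext x
    simp only [SpaceX.coverSet, preimage_ofPred_eq, mem_ofPred_eq, mem_union, mem_compl_iff,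
      SpaceX.emb.injEq]
    exact ⟨fun h => or_iff_not_imp_left.2 fun hx => h x (not_not.1 hx) rfl,
      by rintro h t ht rfl; exact h.resolve_left (not_not.2 ht)⟩
  rw [this]
  exact isClosed_plankT.isOpen_compl.union
    (isOpen_Iio.preimage (continuous_fst.comp continuous_subtype_val))

/-- The cover sets are saturated since `T` is disjoint from `S ∪ {y}`; thus they descend to
`τ_q`-open sets. -/
theorem SpaceX.Rel.mem_coverSet {β : Iic (ω_ 1 : Ordinal.{0})} {x x' : SpaceX}
    (h : SpaceX.Rel x x') (hx : x ∈ SpaceX.coverSet β) : x' ∈ SpaceX.coverSet β := by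
  rcases h with rfl | ⟨-, h⟩
  · exact hx
  · rintro t ht rfl
    exact (notMem_plankS_of_mem_plankT ht (SpaceX.emb_mem_special_iff.1 h)).elim

/-! ### The Glimm space of `A` and the set `K`. -/

namespace ProjSeq

variable {H : Type*} [NormedAddCommGroup H] [InnerProductSpace ℂ H] [CompleteSpace H]
  {p : ProjSeq H} {φ : SpaceX ≃ₜ Prim p.algA}

theorem glimmRel_iff {x x' : SpaceX} : GlimmRel (φ x) (φ x') ↔ SpaceX.Rel x x' := by
  constructor
  · have key : ∀ {x x' : SpaceX}, GlimmRel (φ x) (φ x') → x ∉ SpaceX.special → x = x' := by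
      intro x x' h hx
      by_contra hne
      rcases x with x | _
      · obtain ⟨f, hf, hb, hfx⟩ := SpaceX.exists_separating
          (fun h => hx (SpaceX.emb_mem_special_iff.2 h)) hne
        have := h (BoundedContinuousFunction.ofNormedAddCommGroup (f ∘ φ.symm)
          (hf.comp φ.symm.continuous) 1 fun z => hb _)
        simp only [BoundedContinuousFunction.coe_ofNormedAddCommGroup, Function.comp_apply,
          Homeomorph.symm_apply_apply] at this
        exact hfx this
      · exact hx SpaceX.extra_mem_special
    intro h
    by_cases hx : x ∈ SpaceX.special
    · by_cases hx' : x' ∈ SpaceX.special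
      · exact Or.inr ⟨hx, hx'⟩
      · exact Or.inl (key (fun f => (h f).symm) hx').symm
    · exact Or.inl (key h hx)
  · rintro (rfl | ⟨h, h'⟩) f
    · rfl
    · have hc : Continuous fun z => f (φ z) := f.continuous.comp φ.continuous
      exact (SpaceX.apply_eq_apply_extra hc h).trans (SpaceX.apply_eq_apply_extra hc h').symm

theorem VanishAt.of_repr {a : p.algA} {x : SpaceX} (h : p.VanishAt a x.repr) : p.VanishAt a x := by
  by_cases hx : x ∈ SpaceX.special
  · rw [SpaceX.repr, if_pos hx] at h
    rcases hx with ⟨s, hs, rfl⟩ | rfl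
    · exact apply_sPoint_eq_zero h hs
    · exact h
  · rwa [SpaceX.repr, if_neg hx] at h

/-- On `S ∪ {y}` the ideal of `y` is contained in all the others, so it is their intersection; every
other class is a single point. -/
theorem glimmIdeal_eq (hφ : ∀ x a, a ∈ (φ x).ideal ↔ p.VanishAt a x) (x : SpaceX) :
    glimmIdeal (φ x) = (φ x.repr).ideal := by
  ext a
  rw [mem_glimmIdeal]
  refine ⟨fun h => h _ (glimmRel_iff.2 x.rel_repr), fun h Q hQ => ?_⟩
  obtain ⟨x', rfl⟩ := φ.surjective Q
  rw [SpaceX.rel_iff_repr_eq.1 (glimmRel_iff.1 hQ), hφ] at h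
  rw [hφ]
  exact h.of_repr

theorem glimmMap_eq_iff (hφ : ∀ x a, a ∈ (φ x).ideal ↔ p.VanishAt a x) {x x' : SpaceX} :
    glimmMap (φ x) = glimmMap (φ x') ↔ SpaceX.Rel x x' := by
  rw [glimmMap_eq_iff_ideal, glimmIdeal_eq hφ, glimmIdeal_eq hφ, Prim.ideal_injective.eq_iff,
    φ.injective.eq_iff, SpaceX.rel_iff_repr_eq]

open Classical in
/-- The parametrization of `K` by `[0,Ω]`. -/
noncomputable def paramK (φ : SpaceX ≃ₜ Prim p.algA) (β : Iic (ω_ 1 : Ordinal.{0})) :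
    Glimm p.algA :=
  if h : β = ⊤ then glimmMap (φ SpaceX.extra) else glimmMap (φ (SpaceX.emb (tPoint β h)))

theorem paramK_top : paramK φ ⊤ = glimmMap (φ SpaceX.extra) := dif_pos rfl

theorem paramK_of_ne {β : Iic (ω_ 1 : Ordinal.{0})} (h : β ≠ ⊤) :
    paramK φ β = glimmMap (φ (SpaceX.emb (tPoint β h))) := dif_neg h

theorem range_paramK : range (paramK φ) = p.setK φ := by
  apply Subset.antisymm
  · rintro _ ⟨β, rfl⟩
    by_cases h : β = ⊤
    · rw [h, paramK_top]
      exact ⟨_, Or.inr rfl, rfl⟩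
    · rw [paramK_of_ne h]
      exact ⟨_, Or.inl ⟨_, tPoint_mem β h, rfl⟩, rfl⟩
  · rintro _ ⟨_, ⟨t, ht, rfl⟩ | rfl, rfl⟩
    · refine ⟨t.1.1, ?_⟩
      rw [paramK_of_ne (notMem_plankS_of_mem_plankT ht), ← eq_tPoint ht]
    · exact ⟨⊤, paramK_top⟩

/-- Only the point `Ω` needs an argument: there the function is locally constant by
`eventually_const_on_plankT`. -/
theorem continuous_comp_paramK {g : Glimm p.algA → ℝ}
    {f : BoundedContinuousFunction (Prim p.algA) ℝ} (hgf : ∀ P, g (glimmMap P) = f P) :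
    Continuous (g ∘ paramK φ) := by
  have hF : Continuous fun x => f (φ x) := f.continuous.comp φ.continuous
  have hg : ∀ x, g (glimmMap (φ x)) = f (φ x) := fun x => hgf _
  have htop : (g ∘ paramK φ) ⊤ = f (φ SpaceX.extra) := by
    rw [Function.comp_apply, paramK_top, hg]
  refine continuous_iff_continuousAt.2 fun β => ?_
  by_cases hβ : β = ⊤
  · subst hβ
    obtain ⟨γ, hγ, h⟩ := eventually_const_on_plankT
      (hF.comp SpaceX.isEmbedding_emb.continuous)
      (fun s hs => SpaceX.apply_emb_eq_apply_extra hF hs)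
    refine ContinuousAt.congr (continuousAt_const (y := f (φ SpaceX.extra))) ?_
    filter_upwards [isOpen_Ioi.mem_nhds hγ] with δ hδ
    by_cases h' : δ = ⊤
    · rw [h', htop]
    · rw [Function.comp_apply, paramK_of_ne h', hg]
      exact (h _ (tPoint_mem δ h') hδ).symm
  · refine ContinuousOn.continuousAt (s := {⊤}ᶜ) ?_ (isOpen_compl_singleton.mem_nhds hβ)
    rw [continuousOn_iff_continuous_domRestrict]
    have : ({⊤}ᶜ : Set _).domRestrict (g ∘ paramK φ) =
        fun δ => f (φ (SpaceX.emb (tPoint δ.1 δ.2))) := by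
      ext δ
      exact (congrArg g (paramK_of_ne δ.2)).trans (hg _)
    rw [this]
    exact (hF.comp SpaceX.isEmbedding_emb.continuous).comp continuous_tPoint

/-- As `τ_cr` is an initial topology, `paramK` is continuous once its composition with each defining
function is, and `[0,Ω]` is compact. -/
theorem isCompact_tauCR_setK : @IsCompact _ (tauCR p.algA) (p.setK φ) := by
  let _ := tauCR p.algA
  have h : Continuous (paramK φ) := by
    refine continuous_iInf_rng.2 fun g => continuous_induced_rng.2 ?_
    obtain ⟨g, f, hgf⟩ := g
    exact continuous_comp_paramK hgf
  rw [← range_paramK]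
  exact isCompact_range h

theorem not_isCompact_tauQ_setK (hφ : ∀ x a, a ∈ (φ x).ideal ↔ p.VanishAt a x) :
    ¬ @IsCompact _ (tauQ p.algA) (p.setK φ) := by
  let _ := tauQ p.algA
  intro hK
  let U : {β : Iic (ω_ 1 : Ordinal.{0}) // β < ⊤} → Set (Glimm p.algA) := fun β =>
    (fun x => glimmMap (φ x)) '' SpaceX.coverSet β.1
  have hmem : ∀ β x, glimmMap (φ x) ∈ U β ↔ x ∈ SpaceX.coverSet β.1 := by
    intro β x
    refine ⟨?_, fun h => ⟨x, h, rfl⟩⟩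
    rintro ⟨x', hx', h⟩
    exact ((glimmMap_eq_iff hφ).1 h).mem_coverSet hx'
  have hbot : (⟨⊥, mem_Iic.2 bot_le⟩ : Iic (ω_ 1 : Ordinal.{0})) < ⊤ :=
    lt_top_iff_ne_top.2 fun h => isSuccLimit_omega_one.ne_bot (congrArg Subtype.val h).symm
  have : Nonempty {β : Iic (ω_ 1 : Ordinal.{0}) // β < ⊤} := ⟨⟨_, hbot⟩⟩
  have hU : ∀ β, IsOpen (U β) := by
    intro β
    refine isOpen_coinduced.2 ?_
    have : glimmMap ⁻¹' U β = φ '' SpaceX.coverSet β.1 := by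
      ext P
      obtain ⟨x, rfl⟩ := φ.surjective P
      rw [mem_preimage, hmem, φ.injective.mem_set_image]
    rw [this]
    exact φ.isOpenMap _ (SpaceX.isOpen_coverSet _)
  have hcov : p.setK φ ⊆ ⋃ β, U β := by
    rintro _ ⟨x, hx, rfl⟩
    refine mem_iUnion.2 ?_
    rcases hx with ⟨t, ht, rfl⟩ | rfl
    · obtain ⟨β, h1, h2⟩ := exists_between_top_of_isSuccLimit isSuccLimit_omega_one
        (lt_top_iff_ne_top.2 (notMem_plankS_of_mem_plankT ht))
      refine ⟨⟨β, h2⟩, (hmem _ _).2 ?_⟩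
      rintro t' - h
      rwa [← SpaceX.emb.inj h]
    · exact ⟨⟨_, hbot⟩, (hmem _ _).2 fun t _ h => by simp at h⟩
  have hmono : Monotone U := fun β γ h => image_mono fun x hx t ht hxt =>
    (hx t ht hxt).trans_le h
  -- A directed cover of a compact set would have a single member containing `K`, but `U β` misses
  -- the class of `(β,ω)`.
  obtain ⟨β, hβ⟩ := hK.elim_directed_cover U hU hcov hmono.directed_le
  have h := (hmem β _).1 (hβ ⟨_, Or.inl ⟨_, tPoint_mem β.1 β.2.ne, rfl⟩, rfl⟩)
  exact (h _ (tPoint_mem β.1 β.2.ne) rfl).false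

/-- Off `S`, the norm of an element of `A` in the quotient by a Glimm ideal is at most the modulus
of its first component. -/
theorem quotientNorm_le_norm_apply (hφ : ∀ x a, a ∈ (φ x).ideal ↔ p.VanishAt a x) (a : p.algA)
    {t : Plank} (ht : t ∉ plankS) :
    quotientNorm a (glimmMap (φ (SpaceX.emb t))).ideal ≤ ‖a.1.1 t‖ := by
  refine le_of_forall_gt_imp_ge_of_dense fun α hα => ?_
  have hα0 : 0 ≤ α := (norm_nonneg _).trans hα.le
  obtain ⟨f, hf1, hf0, hf⟩ := exists_bump_zeroAtInfty
    ((isOpen_lt (map_continuous a.1.1).norm continuous_const).inter isClosed_plankS.isOpen_compl)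
    (show t ∈ {x | ‖a.1.1 x‖ < α} ∩ plankSᶜ from ⟨hα, ht⟩)
  -- Cutting `b` down by a bump at `t` supported where `|b| < α` leaves the class of `a` unchanged
  -- and yields a representative of norm at most `α`.
  have hmem : p.ofB (f * a.1.1) - a ∈ (glimmMap (φ (SpaceX.emb t))).ideal := by
    change _ ∈ glimmIdeal (φ (SpaceX.emb t))
    rw [glimmIdeal_eq hφ, hφ, SpaceX.repr, if_neg fun h => ht (SpaceX.emb_mem_special_iff.1 h)]
    change f t * a.1.1 t - a.1.1 t = 0
    rw [hf1, one_mul, sub_self]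
  refine (quotientNorm_le_of_sub_mem hmem).trans ?_
  refine (NonUnitalStarAlgHom.norm_apply_le p.ofB _).trans ?_
  rw [← ZeroAtInftyContinuousMap.norm_toBCF_eq_norm, BoundedContinuousFunction.norm_le hα0]
  intro x
  change ‖f x * a.1.1 x‖ ≤ α
  by_cases hx : x ∈ {x | ‖a.1.1 x‖ < α} ∩ plankSᶜ
  · rw [norm_mul]
    exact (mul_le_of_le_one_left (norm_nonneg _) (hf x)).trans (le_of_lt hx.1)
  · rw [hf0 x hx, zero_mul, norm_zero]
    exact hα0

theorem not_setK_subset (hφ : ∀ x a, a ∈ (φ x).ideal ↔ p.VanishAt a x) (a : p.algA) {α : ℝ}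
    (hα : 0 < α) : ¬ p.setK φ ⊆ {G | α ≤ quotientNorm a G.ideal} := by
  intro h
  refine not_plankT_subset_of_isCompact (isCompact_le_norm a.1.1 hα) fun t ht => ?_
  have h1 : α ≤ quotientNorm a (glimmMap (φ (SpaceX.emb t))).ideal :=
    h ⟨_, Or.inl ⟨t, ht, rfl⟩, rfl⟩
  exact h1.trans (quotientNorm_le_norm_apply hφ a (notMem_plankS_of_mem_plankT ht))

end ProjSeq

end GlimmSpace

theorem mainTheorem5 {H : Type*} [NormedAddCommGroup H] [InnerProductSpace ℂ H] [CompleteSpace H]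
    [TopologicalSpace.SeparableSpace H] (hH : ¬ FiniteDimensional ℂ H) :
    Nonempty (GlimmSpace.ProjSeq H) ∧
    LocallyCompactSpace GlimmSpace.SpaceX ∧ T0Space GlimmSpace.SpaceX ∧
    ∀ p : GlimmSpace.ProjSeq H, ∃ φ : GlimmSpace.SpaceX ≃ₜ GlimmSpace.Prim p.algA,
      -- the identification of `X` with `Prim(A)`
      (∀ (x : GlimmSpace.Plank) (a : p.algA),
        a ∈ (φ (GlimmSpace.SpaceX.emb x)).ideal ↔ a.1.1 x = 0) ∧
      (∀ a : p.algA, a ∈ (φ GlimmSpace.SpaceX.extra).ideal ↔ a.1.2 = 0) ∧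
      -- `S ∪ {y}` is one equivalence class, and all the other classes are single points
      (∀ x x' : GlimmSpace.SpaceX,
        GlimmSpace.glimmMap (φ x) = GlimmSpace.glimmMap (φ x') ↔
          x = x' ∨
            (x ∈ GlimmSpace.SpaceX.emb '' GlimmSpace.plankS ∪ {GlimmSpace.SpaceX.extra} ∧
              x' ∈ GlimmSpace.SpaceX.emb '' GlimmSpace.plankS ∪ {GlimmSpace.SpaceX.extra})) ∧
      -- `K` is compact for `τ_cr` but not for `τ_q`, and no norm inequality covers it
      @IsCompact _ (GlimmSpace.tauCR p.algA) (p.setK φ) ∧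
      ¬ @IsCompact _ (GlimmSpace.tauQ p.algA) (p.setK φ) ∧
      ∀ (a : p.algA) (α : ℝ), 0 < α →
        ¬ p.setK φ ⊆ {G | α ≤ GlimmSpace.quotientNorm a G.ideal} := by
  refine ⟨GlimmSpace.nonempty_projSeq hH, inferInstance, inferInstance, fun p => ?_⟩
  obtain ⟨φ, hφ⟩ := p.exists_homeomorph_prim
  exact ⟨φ, fun x => hφ _, hφ _, fun x x' => GlimmSpace.ProjSeq.glimmMap_eq_iff hφ,
    GlimmSpace.ProjSeq.isCompact_tauCR_setK, GlimmSpace.ProjSeq.not_isCompact_tauQ_setK hφ,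
    fun a α hα => GlimmSpace.ProjSeq.not_setK_subset hφ a hα⟩
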